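/- Let $\mathbb{R}_5$ be the real Clifford algebra with units $e_1,\dots,e_5$, $e_i^2=-1$, $e_ie_j=-e_je_i$ for $i\neq j$; identify $x\in\mathbb{R}^6$ with the paravector $x_0+\underline{x}$, $\underline{x}=x_1e_1+\dots+x_5e_5$, and let $\mathbb{S}=\{I=\underline{x} : |\underline{x}|=1\}$ and $\mathbb{C}_I=\mathbb{R}+I\mathbb{R}$ for $I\in\mathbb{S}$. Let $V$ be a real Banach space, $V_5=V\otimes\mathbb{R}_5$, and let $\mathcal{B}(V_5)$ be the Banach algebra of bounded right linear operators on $V_5$, in which $a\in\mathbb{R}_5$ stands for left multiplication by $a$. Let $T=e_1T_1+\dots+e_5T_5$, where $T_1,\dots,T_5$ are pairwise commuting bounded operators on $V$ with real spectra, and $\overline{T}=-T$. Put $$\sigma_S(T)=\{s\in\mathbb{R}^6 : T^2-2\,\mathrm{Re}(s)\,T+|s|^2\ \text{is not invertible in } \mathcal{B}(V_5)\},$$ and, for $s\notin\sigma_S(T)$, $$S^{-1}_{D,L}(s,T)=S^{-1}_{D,R}(s,T)=-4\,\bigl(s^2-s(T+\overline{T})+T\overline{T}\bigr)^{-1}.$$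 Suppose that $\sigma_S(T)=\sigma_{1}\cup\sigma_{2}$ with $\mathrm{dist}(\sigma_1,\sigma_2)>0$. Call a bounded open set $G\subset\mathbb{R}^6$ admissible if it is a bounded slice Cauchy domain: it is axially symmetric (with $x$ it contains $\mathrm{Re}(x)+J|\underline{x}|$ for all $J\in\mathbb{S}$), and for every $J\in\mathbb{S}$ the boundary of $G\cap\mathbb{C}_J$ in $\mathbb{C}_J$ is a finite union of pairwise disjoint piecewise $C^1$ Jordan curves, with $G\cap\mathbb{C}_J$ on exactly one side of each. Let $G_1,G_2$ be admissible sets with $\sigma_1\subset G_1$, $\overline{G_1}\subset G_2$ and $\mathrm{dist}(G_2,\sigma_2)>0$. (Distances to the empty set are $+\infty$.) Let $I\in\mathbb{S}$, let $\partial(G_j\cap\mathbb{C}_I)$ be positively oriented, and $ds_I=ds\,(-I)$. Then $$P:=-\frac{1}{8\pi}\int_{\partial(G_1\cap\mathbb{C}_I)}S^{-1}_{D,R}(p,T)\,dp_I\,p$$ is a projection, $P^2=P$, and $$P=-\frac{1}{8\pi}\int_{\partial(G_2\cap\mathbb{C}_I)}s\,ds_I\,S^{-1}_{D,L}(s,T).$$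 -/

import Mathlib

open MeasureTheory Set

noncomputable section

namespace SliceOp

/-! ### The real Clifford algebra and the Clifford module over a real Banach space -/

/-- The quadratic form `x ↦ -(x₁² + ⋯ + xₙ²)` on `ℝⁿ`. -/
abbrev negSq (n : ℕ) : QuadraticForm ℝ (Fin n → ℝ) :=
  QuadraticMap.weightedSumSquares ℝ (fun _ : Fin n => (-1 : ℝ))

/-- The real Clifford algebra `ℝₙ`, with units `eᵢ`, `eᵢ² = -1`, `eᵢ eⱼ = -eⱼ eᵢ` for `i ≠ j`. -/
abbrev Cl (n : ℕ) : Type := CliffordAlgebra (negSq n)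

/-- The Clifford module `Vₙ = V ⊗ ℝₙ`: the element `∑_A e_A v_A` is the family of its components
`v_A ∈ V`, `A` a set of indices, `e_A = e_{l₁} ⋯ e_{lᵣ}` for `A = {l₁ < ⋯ < lᵣ}`.
It is a Banach space for the maximum of the norms of the components. -/
abbrev CMod (n : ℕ) (V : Type*) : Type _ := Finset (Fin n) → V

variable {n : ℕ} {V : Type*} [NormedAddCommGroup V] [NormedSpace ℝ V]

/-- The set of indices of `± eᵢ e_A = ± e_A eᵢ`. -/
def toggle (i : Fin n) (A : Finset (Fin n)) : Finset (Fin n) := symmDiff A {i}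

/-- The sign in `eᵢ e_A = leftSign i A • e_(toggle i A)`. -/
def leftSign (i : Fin n) (A : Finset (Fin n)) : ℝ := (-1) ^ (A.filter (fun j => j ≤ i)).card

/-- The sign in `e_A eᵢ = rightSign i A • e_(toggle i A)`. -/
def rightSign (i : Fin n) (A : Finset (Fin n)) : ℝ := (-1) ^ (A.filter (fun j => i ≤ j)).card

/-- Left multiplication by `eᵢ` on `Vₙ`. -/
def leftGen (i : Fin n) : CMod n V →L[ℝ] CMod n V :=
  ContinuousLinearMap.pi fun B =>
    leftSign i (toggle i B) • ContinuousLinearMap.proj (R := ℝ) (φ := fun _ => V) (toggle i B)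

/-- Right multiplication by `eᵢ` on `Vₙ`. -/
def rightGen (i : Fin n) : CMod n V →L[ℝ] CMod n V :=
  ContinuousLinearMap.pi fun B =>
    rightSign i (toggle i B) • ContinuousLinearMap.proj (R := ℝ) (φ := fun _ => V) (toggle i B)

/-- The operator `∑_A e_A v_A ↦ ∑_A e_A S(v_A)` on `Vₙ` of an operator `S` on `V`. -/
def ext (S : V →L[ℝ] V) : CMod n V →L[ℝ] CMod n V :=
  ContinuousLinearMap.piMap fun _ => S

theorem leftGen_apply (i : Fin n) (v : CMod n V) (B : Finset (Fin n)) :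
    leftGen i v B = leftSign i (toggle i B) • v (toggle i B) := rfl

theorem rightGen_apply (i : Fin n) (v : CMod n V) (B : Finset (Fin n)) :
    rightGen i v B = rightSign i (toggle i B) • v (toggle i B) := rfl

theorem ext_apply (S : V →L[ℝ] V) (v : CMod n V) (B : Finset (Fin n)) :
    ext S v B = S (v B) := rfl

theorem toggle_toggle (i : Fin n) (A : Finset (Fin n)) : toggle i (toggle i A) = A := by
  simp [toggle]

theorem toggle_comm (i k : Fin n) (A : Finset (Fin n)) :
    toggle i (toggle k A) = toggle k (toggle i A) := by
  simp only [toggle]; exact symmDiff_right_comm _ _ _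

theorem sign_toggle (p : Fin n → Prop) [DecidablePred p] (i : Fin n) (A : Finset (Fin n)) :
    (-1 : ℝ) ^ ((toggle i A).filter p).card
      = if p i then -(-1 : ℝ) ^ (A.filter p).card else (-1 : ℝ) ^ (A.filter p).card := by
  by_cases hA : i ∈ A
  · have h : toggle i A = A.erase i := by
      ext j; simp only [toggle, Finset.mem_symmDiff, Finset.mem_singleton, Finset.mem_erase]
      grind
    rw [h, Finset.filter_erase]
    split_ifs with hp
    · have hm : i ∈ A.filter p := by simp [hA, hp]
      rw [← Finset.card_erase_add_one hm, pow_succ]; ring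
    · rw [Finset.erase_eq_of_notMem (by simp [hp])]
  · have h : toggle i A = insert i A := by
      ext j; simp only [toggle, Finset.mem_symmDiff, Finset.mem_singleton, Finset.mem_insert]
      grind
    rw [h, Finset.filter_insert]
    split_ifs with hp
    · rw [Finset.card_insert_of_notMem (by simp [hA]), pow_succ]; ring
    · rfl

theorem leftSign_toggle (i k : Fin n) (A : Finset (Fin n)) :
    leftSign k (toggle i A) = if i ≤ k then -leftSign k A else leftSign k A :=
  sign_toggle (fun j => j ≤ k) i A

theorem rightSign_toggle (i k : Fin n) (A : Finset (Fin n)) :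
    rightSign k (toggle i A) = if k ≤ i then -rightSign k A else rightSign k A :=
  sign_toggle (fun j => k ≤ j) i A

theorem leftSign_sq (i : Fin n) (A : Finset (Fin n)) : leftSign i A * leftSign i A = 1 := by
  simp [leftSign, ← pow_add, ← two_mul]

theorem rightSign_sq (i : Fin n) (A : Finset (Fin n)) : rightSign i A * rightSign i A = 1 := by
  simp [rightSign, ← pow_add, ← two_mul]

theorem leftGen_sq (i : Fin n) : (leftGen i : CMod n V →L[ℝ] CMod n V) * leftGen i = -1 := by
  ext v B
  simp [leftGen_apply, toggle_toggle, leftSign_toggle, smul_smul, leftSign_sq]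

theorem rightGen_sq (i : Fin n) : (rightGen i : CMod n V →L[ℝ] CMod n V) * rightGen i = -1 := by
  ext v B
  simp [rightGen_apply, toggle_toggle, rightSign_toggle, smul_smul, rightSign_sq]

theorem leftGen_anticomm {i k : Fin n} (h : i ≠ k) :
    (leftGen i : CMod n V →L[ℝ] CMod n V) * leftGen k = -(leftGen k * leftGen i) := by
  ext v B
  simp only [mul_apply_eq_comp, neg_apply, Pi.neg_apply,
    leftGen_apply, smul_smul, toggle_comm k i B, leftSign_toggle, ← neg_smul]
  congr 1
  rcases lt_or_gt_of_ne h with h | h <;> simp [h.le, h.not_ge] <;> ring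

theorem rightGen_anticomm {i k : Fin n} (h : i ≠ k) :
    (rightGen i : CMod n V →L[ℝ] CMod n V) * rightGen k = -(rightGen k * rightGen i) := by
  ext v B
  simp only [mul_apply_eq_comp, neg_apply, Pi.neg_apply,
    rightGen_apply, smul_smul, toggle_comm k i B, rightSign_toggle, ← neg_smul]
  congr 1
  rcases lt_or_gt_of_ne h with h | h <;> simp [h.le, h.not_ge] <;> ring

theorem leftGen_rightGen (i k : Fin n) :
    (leftGen i : CMod n V →L[ℝ] CMod n V) * rightGen k = rightGen k * leftGen i := by
  ext v B
  simp only [mul_apply_eq_comp, leftGen_apply, rightGen_apply, smul_smul,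
    toggle_comm k i B, leftSign_toggle, rightSign_toggle]
  congr 1
  by_cases h : k ≤ i <;> simp [h] <;> ring

theorem ext_rightGen (S : V →L[ℝ] V) (k : Fin n) :
    (ext S : CMod n V →L[ℝ] CMod n V) * rightGen k = rightGen k * ext S := by
  ext v B
  simp [ext_apply, rightGen_apply]

theorem sum_smul_sq {A : Type*} [Ring A] [Algebra ℝ A] (E : Fin n → A)
    (hsq : ∀ i, E i * E i = -1) (hac : ∀ i k, i ≠ k → E i * E k = -(E k * E i))
    (x : Fin n → ℝ) :
    (∑ i, x i • E i) * (∑ i, x i • E i) = algebraMap ℝ A (negSq n x) := by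
  have h1 : (∑ i, x i • E i) * (∑ i, x i • E i) = ∑ i, ∑ k, (x i * x k) • (E i * E k) := by
    rw [Finset.sum_mul_sum]
    exact Finset.sum_congr rfl fun i _ => Finset.sum_congr rfl fun k _ => smul_mul_smul_comm _ _ _ _
  have h2 : (2 : ℝ) • ((∑ i, x i • E i) * (∑ i, x i • E i))
      = (2 : ℝ) • algebraMap ℝ A (negSq n x) := by
    have h3 : (∑ i, x i • E i) * (∑ i, x i • E i)
        = ∑ i, ∑ k, (x i * x k) • (E k * E i) := by
      rw [h1, Finset.sum_comm]
      exact Finset.sum_congr rfl fun i _ => Finset.sum_congr rfl fun k _ => by rw [mul_comm]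
    have h4 : ∀ i k, (x i * x k) • (E i * E k) + (x i * x k) • (E k * E i)
        = if i = k then (-2 * (x i * x i)) • (1 : A) else 0 := by
      intro i k
      split_ifs with h
      · subst h
        rw [hsq, ← add_smul, smul_neg, ← neg_smul]; congr 1; ring
      · rw [hac i k h, smul_neg, neg_add_cancel]
    rw [two_smul]
    nth_rewrite 1 [h1]
    rw [h3, ← Finset.sum_add_distrib]
    simp_rw [← Finset.sum_add_distrib, h4]
    simp [QuadraticMap.weightedSumSquares_apply, Algebra.algebraMap_eq_smul_one, Finset.smul_sum,
      Finset.sum_smul, smul_smul]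
  exact smul_right_injective A (two_ne_zero' ℝ) h2

/-- Left multiplication `v ↦ a v` by elements `a` of the Clifford algebra on `Vₙ`. -/
def leftMul : Cl n →ₐ[ℝ] (CMod n V →L[ℝ] CMod n V) :=
  CliffordAlgebra.lift (negSq n)
    ⟨Fintype.linearCombination ℝ leftGen, fun x => by
      simpa [Fintype.linearCombination_apply] using
        sum_smul_sq (A := CMod n V →L[ℝ] CMod n V) leftGen leftGen_sq
          (fun _ _ h => leftGen_anticomm h) x⟩

/-- Right multiplication `v ↦ v a` by elements `a` of the Clifford algebra on `Vₙ`. -/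
def rightMul : Cl n →ₐ[ℝ] (CMod n V →L[ℝ] CMod n V)ᵐᵒᵖ :=
  CliffordAlgebra.lift (negSq n)
    ⟨Fintype.linearCombination ℝ fun i => MulOpposite.op (rightGen i), fun x => by
      simpa [Fintype.linearCombination_apply] using
        sum_smul_sq (A := (CMod n V →L[ℝ] CMod n V)ᵐᵒᵖ)
          (fun i => MulOpposite.op (rightGen i))
          (fun i => by rw [← MulOpposite.op_mul, rightGen_sq]; rfl)
          (fun i k h => by
            rw [← MulOpposite.op_mul, ← MulOpposite.op_mul, rightGen_anticomm h.symm]; rfl) x⟩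

variable (n V) in
/-- `B(Vₙ)`: the real Banach algebra of bounded right linear operators on `Vₙ`. -/
def CliffordOp : Subalgebra ℝ (CMod n V →L[ℝ] CMod n V) :=
  Subalgebra.centralizer ℝ (Set.range fun a : Cl n => (rightMul (V := V) a).unop)

instance [CompleteSpace V] : CompleteSpace (CliffordOp n V) :=
  (Set.isClosed_centralizer
    (Set.range fun a : Cl n => (rightMul (V := V) a).unop)).completeSpace_coe

theorem commute_rightMul {X : CMod n V →L[ℝ] CMod n V}
    (hX : ∀ i, X * rightGen i = rightGen i * X) (a : Cl n) :
    (rightMul (V := V) a).unop * X = X * (rightMul (V := V) a).unop := by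
  induction a using CliffordAlgebra.induction with
  | algebraMap r =>
    rw [AlgHom.commutes, MulOpposite.algebraMap_apply, MulOpposite.unop_op]
    exact Algebra.commutes r X
  | ι x =>
    rw [rightMul, CliffordAlgebra.lift_ι_apply, Fintype.linearCombination_apply,
      Finset.unop_sum, Finset.sum_mul, Finset.mul_sum]
    refine Finset.sum_congr rfl fun i _ => ?_
    rw [MulOpposite.unop_smul, MulOpposite.unop_op, smul_mul_assoc, mul_smul_comm, hX]
  | mul a b ha hb =>
    rw [map_mul, MulOpposite.unop_mul, mul_assoc, ha, ← mul_assoc, hb, mul_assoc]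
  | add a b ha hb =>
    rw [map_add, MulOpposite.unop_add, add_mul, mul_add, ha, hb]

theorem mem_cliffordOp {X : CMod n V →L[ℝ] CMod n V}
    (hX : ∀ i, X * rightGen i = rightGen i * X) : X ∈ CliffordOp n V := by
  rintro _ ⟨a, rfl⟩
  exact commute_rightMul hX a

theorem leftMul_mem (a : Cl n) : leftMul (V := V) a ∈ CliffordOp n V := by
  refine mem_cliffordOp fun k => ?_
  induction a using CliffordAlgebra.induction with
  | algebraMap r => rw [AlgHom.commutes]; exact Algebra.commutes r _
  | ι x =>
    rw [leftMul, CliffordAlgebra.lift_ι_apply, Fintype.linearCombination_apply,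
      Finset.sum_mul, Finset.mul_sum]
    refine Finset.sum_congr rfl fun i _ => ?_
    rw [smul_mul_assoc, mul_smul_comm, leftGen_rightGen]
  | mul a b ha hb => rw [map_mul, mul_assoc, hb, ← mul_assoc, ha, mul_assoc]
  | add a b ha hb => rw [map_add, add_mul, mul_add, ha, hb]

/-- The operator `a 𝓘` in `B(Vₙ)`: left multiplication by the Clifford number `a`. In products of
operators and Clifford numbers, a Clifford number `a` stands for this operator. -/
def scalar : Cl n →ₐ[ℝ] CliffordOp n V := leftMul.codRestrict (CliffordOp n V) leftMul_mem

/-- The operator in `B(Vₙ)` given by a bounded operator on `V`. -/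
def comp (S : V →L[ℝ] V) : CliffordOp n V :=
  ⟨ext S, mem_cliffordOp fun k => ext_rightGen S k⟩

/-! ### Paravectors, slices and slice Cauchy domains -/

/-- `ℝⁿ⁺¹` with the Euclidean norm, as the space of paravectors `x = x₀ + x₁e₁ + ⋯ + xₙeₙ`:
`x.fst` is the real part `x₀`, and `x.snd = (x₁, …, xₙ)`. -/
abbrev Para (n : ℕ) : Type := WithLp 2 (ℝ × EuclideanSpace ℝ (Fin n))

/-- The Clifford number `x₀ + x₁e₁ + ⋯ + xₙeₙ`. -/
def Para.toCl (x : Para n) : Cl n :=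
  algebraMap ℝ (Cl n) x.fst + CliffordAlgebra.ι (negSq n) (x.snd : Fin n → ℝ)

/-- The sphere `𝕊` of the unit vectors `I = I₁e₁ + ⋯ + Iₙeₙ`, i.e. `I² = -1`. -/
abbrev UnitVec (n : ℕ) : Type := Metric.sphere (0 : EuclideanSpace ℝ (Fin n)) 1

/-- The point `u + I v` of the complex plane `ℂ_I` in `ℝⁿ⁺¹`, for `z = u + i v`. -/
def slicePoint (I : UnitVec n) (z : ℂ) : Para n :=
  WithLp.toLp 2 (z.re, z.im • (I : EuclideanSpace ℝ (Fin n)))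

/-- `U ∩ ℂ_I`, as a subset of `ℂ`. -/
def slice (U : Set (Para n)) (I : UnitVec n) : Set ℂ := slicePoint I ⁻¹' U

/-- `U` contains, with `x`, the sphere `[x] = {Re x + J |x̲| : J ∈ 𝕊}`. -/
def IsAxiallySymmetric (U : Set (Para n)) : Prop :=
  ∀ x ∈ U, ∀ J : UnitVec n, slicePoint J ⟨x.fst, ‖x.snd‖⟩ ∈ U

/-- `γ`, restricted to `[0, 1]`, is a piecewise `C¹` closed Jordan curve. -/
structure IsPiecewiseC1Jordan (γ : ℝ → ℂ) : Prop where
  continuousOn : ContinuousOn γ (Icc 0 1)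
  closed : γ 0 = γ 1
  injOn : InjOn γ (Ico 0 1)
  piecewise : ∃ (k : ℕ) (t : Fin (k + 1) → ℝ), StrictMono t ∧ t 0 = 0 ∧ t (Fin.last k) = 1 ∧
    ∀ i : Fin k, ContDiffOn ℝ 1 γ (Icc (t i.castSucc) (t i.succ))

/-- The winding number `(2πi)⁻¹ ∫_γ dζ / (ζ - z)`. -/
def winding (γ : ℝ → ℂ) (z : ℂ) : ℂ :=
  (2 * Real.pi * Complex.I)⁻¹ * ∫ t in (0 : ℝ)..1, deriv γ t / (γ t - z)

/-- The curves `γ₁, …, γₘ` are pairwise disjoint piecewise `C¹` Jordan curves which together form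
the boundary of `D`, and they are positively oriented with respect to `D`: together they wind
once around every point of `D`, and not around the points outside of the closure of `D`. -/
structure IsOrientedBoundary (D : Set ℂ) {m : ℕ} (γ : Fin m → ℝ → ℂ) : Prop where
  jordan : ∀ j, IsPiecewiseC1Jordan (γ j)
  disjoint : Pairwise fun j k => Disjoint (γ j '' Icc 0 1) (γ k '' Icc 0 1)
  frontier_eq : frontier D = ⋃ j, γ j '' Icc 0 1
  winding_inside : ∀ z ∈ D, ∑ j, winding (γ j) z = 1
  winding_outside : ∀ z, z ∉ closure D → ∑ j, winding (γ j) z = 0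

/-- Bounded slice Cauchy domains: bounded axially symmetric open sets whose slices are Cauchy
domains, i.e. have a boundary that consists of finitely many disjoint piecewise `C¹` Jordan curves
(with the slice on exactly one side of each, so that the boundary has its positive orientation). -/
structure IsBoundedSliceCauchyDomain (U : Set (Para n)) : Prop where
  isBounded : Bornology.IsBounded U
  isOpen : IsOpen U
  axiallySymmetric : IsAxiallySymmetric U
  cauchy : ∀ J : UnitVec n, ∃ (m : ℕ) (γ : Fin m → ℝ → ℂ), IsOrientedBoundary (slice U J) γ

/-! ### Paravector operators with commuting components, the `S`-spectrum, resolvents -/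

variable (n V) in
/-- `BC^{0,1}(Vₙ)`: the components of paravector operators `T = T₀ + e₁T₁ + ⋯ + eₙTₙ` with
pairwise commuting bounded components. -/
structure ParaOp where
  /-- the component `T₀` -/
  re : V →L[ℝ] V
  /-- the components `T₁, …, Tₙ` -/
  im : Fin n → V →L[ℝ] V
  commute_re : ∀ i, Commute re (im i)
  commute_im : ∀ i k, Commute (im i) (im k)

/-- The Clifford number `eᵢ`. -/
def gen (i : Fin n) : Cl n := CliffordAlgebra.ι (negSq n) (Pi.single i 1)

/-- `T = T₀ + ∑ eᵢ Tᵢ` as an element of `B(Vₙ)`. -/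
def ParaOp.op (T : ParaOp n V) : CliffordOp n V :=
  comp T.re + ∑ i, scalar (gen i) * comp (T.im i)

/-- `T̄ = T₀ - ∑ eᵢ Tᵢ` as an element of `B(Vₙ)`. -/
def ParaOp.conj (T : ParaOp n V) : CliffordOp n V :=
  comp T.re - ∑ i, scalar (gen i) * comp (T.im i)

/-- The `S`-spectrum: the paravectors `s` such that `T² - 2 Re(s) T + |s|²` is not invertible in
`B(Vₙ)`. -/
def sSpectrum (T : ParaOp n V) : Set (Para n) :=
  {s | ¬ IsUnit (T.op ^ 2 - (2 * s.fst) • T.op + (‖s‖ ^ 2) • (1 : CliffordOp n V))}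

/-- `Q_{c,s}(T) = s² - s (T + T̄) + T T̄`. -/
def pseudoQ (T : ParaOp n V) (s : Para n) : CliffordOp n V :=
  scalar (s.toCl ^ 2) - scalar s.toCl * (T.op + T.conj) + T.op * T.conj

/-- The resolvent operator `S_{D,L}⁻¹(s,T) = S_{D,R}⁻¹(s,T) = -4 Q_{c,s}⁻¹(T)` of the biharmonic
functional calculus in dimension `n = 5`. -/
def resolventD (T : ParaOp 5 V) (s : Para 5) : CliffordOp 5 V :=
  (-4 : ℝ) • Ring.inverse (pseudoQ T s)

/-- The bounded operator `S` on the real Banach space `V` has real spectrum: `a + ib` with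
`b ≠ 0` is never in the spectrum of (the complexification of) `S`, i.e. `(S - a)² + b²`
is invertible. -/
def HasRealSpectrum (S : V →L[ℝ] V) : Prop :=
  ∀ a b : ℝ, b ≠ 0 → IsUnit ((S - a • (1 : V →L[ℝ] V)) ^ 2 + b ^ 2 • (1 : V →L[ℝ] V))

/-- The integral `∫ F(s) ds_I G(s)`, `ds_I = ds (-I)`, of functions `F, G` with values in `B(Vₙ)`
along the curves `γ₁, …, γₘ` in `ℂ_I ≅ ℂ`. -/
def sliceIntegral (I : UnitVec n) {m : ℕ} (γ : Fin m → ℝ → ℂ)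
    (F G : Para n → CliffordOp n V) : CliffordOp n V :=
  ∑ j, ∫ t in (0 : ℝ)..1, F (slicePoint I (γ j t)) *
    scalar ((slicePoint I (deriv (γ j) t)).toCl * -(slicePoint I Complex.I).toCl) *
      G (slicePoint I (γ j t))

end SliceOp

end

open MeasureTheory Set

noncomputable section

namespace SliceOp

open Filter Topology Interval

/-! ### Resolvents in a real Banach algebra that contains a copy of ℂ, and Liouville's theorem -/

section Banach

variable {A : Type*} [NormedRing A] [NormedAlgebra ℝ A]

/-! Since `T.re = 0` and the components commute, T² = -x with x = ∑ Tᵢ² (`ParaOp.imSq`), while T +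
T̄ = 0 and T T̄ = x; hence Q(s) = s² + x. Left multiplication by ℂ_I commutes with x, although in
general not with T, so on a slice both integrands are the same multiple of z (z² + x)⁻¹ dz, and both
integrals have the form P_γ = (2πi)⁻¹ ∫_γ z (z² + x)⁻¹ dz (`rieszProj`).

Write R(u) = (u + x)⁻¹. The resolvent identity and partial fractions give (2πi)⁻¹ ∫_γ z (z² - w²)⁻¹
R(z²) dz = (c(w) - P_γ) R(w²), where c(w) is the mean of the winding numbers about w and -w
(`IsCycle.rieszCauchy_eq`). The left side C_γ(w) is holomorphic wherever ±w lie off γ, even where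
R(w²) does not exist. If c is 0 or 1, then (c - P)(P + c - 1) = P - P², so R(w²)(P - P²) extends
holomorphically across its singularities. It tends to 0 at infinity, hence vanishes by Liouville,
and P² = P. Two contours are compared in the same way, through R(w²)(P_γ - P_γ') = C_γ'(w) - C_γ(w)
where the mean winding numbers agree. No contour is deformed: only winding numbers near the singular
set enter.

It remains to locate that set. Real spectra force z² + x to be invertible for Re z ≠ 0, by Gelfand
theory (`isUnit_add_sum_sq`); on the imaginary axis z² + x is minus the operator that defines the
S-spectrum. So singular points w are imaginary and lie in the S-spectrum, and by axial symmetry w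
and -w are both in G₁ or both outside the closure of G₂. -/

theorem continuous_complexHom (φ : ℂ →ₐ[ℝ] A) : Continuous φ :=
  φ.toLinearMap.continuous_of_finiteDimensional

/-- The functional `x ↦ ℓ(x) - i ℓ(φ(i) x)`, which is complex linear for the complex structure that
`φ` induces on `A`. -/
def complexFunctional (φ : ℂ →ₐ[ℝ] A) (l : A →L[ℝ] ℝ) : A →L[ℝ] ℂ :=
  Complex.ofRealCLM.comp l
    - Complex.I • Complex.ofRealCLM.comp (l.comp (ContinuousLinearMap.mul ℝ A (φ Complex.I)))

theorem complexFunctional_apply (φ : ℂ →ₐ[ℝ] A) (l : A →L[ℝ] ℝ) (x : A) :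
    complexFunctional φ l x = (l x : ℂ) - Complex.I * (l (φ Complex.I * x) : ℂ) := rfl

theorem complexHom_apply (φ : ℂ →ₐ[ℝ] A) (z : ℂ) :
    φ z = z.re • (1 : A) + z.im • φ Complex.I := by
  conv_lhs => rw [← Complex.re_add_im z]
  rw [map_add, ← Complex.real_smul, ← mul_one (z.re : ℂ), ← Complex.real_smul, map_smul, map_smul,
    map_one]

theorem complexFunctional_smul (φ : ℂ →ₐ[ℝ] A) (l : A →L[ℝ] ℝ) (z : ℂ) (x : A) :
    complexFunctional φ l (φ z * x) = z * complexFunctional φ l x := by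
  have h : φ Complex.I * (φ Complex.I * x) = -x := by
    rw [← mul_assoc, ← map_mul, Complex.I_mul_I, map_neg, map_one, neg_one_mul]
  simp only [complexFunctional_apply, complexHom_apply φ z, add_mul, smul_mul_assoc,
    one_mul, h, map_add, map_smul, map_neg]
  apply Complex.ext <;> simp

/-- The real part of the functional is `l` itself, and real functionals separate points by
Hahn–Banach. -/
theorem eq_zero_of_complexFunctional (φ : ℂ →ₐ[ℝ] A) {x : A}
    (h : ∀ l, complexFunctional φ l x = 0) : x = 0 := by
  refine SeparatingDual.eq_zero_of_forall_dual_eq_zero (R := ℝ) fun l => ?_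
  simpa [complexFunctional_apply] using congrArg Complex.re (h l)

/-- The resolvent `(φ(u) + x)⁻¹`. -/
def resolventAt (φ : ℂ →ₐ[ℝ] A) (x : A) (u : ℂ) : A := Ring.inverse (φ u + x)

theorem commute_resolventAt {φ : ℂ →ₐ[ℝ] A} {x y : A} (hφ : ∀ z, Commute (φ z) y)
    (hx : Commute x y) (u : ℂ) : Commute (resolventAt φ x u) y := by
  by_cases h : IsUnit (φ u + x)
  · obtain ⟨v, hv⟩ := h
    rw [resolventAt, ← hv, Ring.inverse_unit]
    have h2 : Commute (v : A) y := hv ▸ (hφ u).add_left hx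
    exact h2.units_inv_left
  · rw [resolventAt, Ring.inverse_non_unit _ h]
    exact Commute.zero_left y

theorem commute_complexHom_resolventAt {φ : ℂ →ₐ[ℝ] A} {x : A} (hx : ∀ z, Commute (φ z) x)
    (u z : ℂ) : Commute (φ z) (resolventAt φ x u) :=
  (commute_resolventAt (fun w => (Commute.all w z).map φ) (hx z).symm u).symm

theorem resolventAt_sub {φ : ℂ →ₐ[ℝ] A} {x : A} (hx : ∀ z, Commute (φ z) x) {u v : ℂ}
    (hu : IsUnit (φ u + x)) (hv : IsUnit (φ v + x)) :
    resolventAt φ x u - resolventAt φ x v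
      = φ (v - u) * (resolventAt φ x u * resolventAt φ x v) := by
  have h1 : resolventAt φ x u * (φ u + x) = 1 := Ring.inverse_mul_cancel _ hu
  have h2 : (φ v + x) * resolventAt φ x v = 1 := Ring.mul_inverse_cancel _ hv
  have h3 := commute_complexHom_resolventAt hx u (v - u)
  rw [← mul_assoc, h3.eq]
  calc resolventAt φ x u - resolventAt φ x v
      = resolventAt φ x u * ((φ v + x) * resolventAt φ x v)
        - (resolventAt φ x u * (φ u + x)) * resolventAt φ x v := by rw [h1, h2, mul_one, one_mul]
    _ = _ := by rw [map_sub]; noncomm_ring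

theorem tendsto_complexHom_inv (φ : ℂ →ₐ[ℝ] A) :
    Tendsto (fun u : ℂ => φ u⁻¹) (cocompact ℂ) (𝓝 0) := by
  have h := (continuous_complexHom φ).tendsto 0
  rw [map_zero] at h
  rw [← Metric.cobounded_eq_cocompact]
  exact h.comp tendsto_inv₀_cobounded

theorem tendsto_one_add_complexHom_inv (φ : ℂ →ₐ[ℝ] A) (x : A) :
    Tendsto (fun u : ℂ => 1 + φ u⁻¹ * x) (cocompact ℂ) (𝓝 1) := by
  simpa using ((tendsto_complexHom_inv φ).mul_const x).const_add 1

theorem complexHom_mul_one_add (φ : ℂ →ₐ[ℝ] A) (x : A) {u : ℂ} (hu : u ≠ 0) :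
    φ u + x = φ u * (1 + φ u⁻¹ * x) := by
  rw [mul_add, ← mul_assoc, ← map_mul, mul_inv_cancel₀ hu, map_one, mul_one, one_mul]

theorem eventually_ne_zero_cocompact : ∀ᶠ u : ℂ in cocompact ℂ, u ≠ 0 :=
  (Set.finite_singleton (0 : ℂ)).isCompact.compl_mem_cocompact

variable [CompleteSpace A]

theorem isOpen_isUnit_add (φ : ℂ →ₐ[ℝ] A) (x : A) : IsOpen {u | IsUnit (φ u + x)} :=
  Units.isOpen.preimage ((continuous_complexHom φ).add_const x)

theorem continuousAt_resolventAt {φ : ℂ →ₐ[ℝ] A} {x : A} {u : ℂ} (hu : IsUnit (φ u + x)) :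
    ContinuousAt (resolventAt φ x) u := by
  obtain ⟨v, hv⟩ := hu
  have h1 : ContinuousAt Ring.inverse (φ u + x) := hv ▸ NormedRing.inverse_continuousAt v
  exact h1.comp (f := fun u => φ u + x) ((continuous_complexHom φ).add_const x).continuousAt

/-- The real derivative of the resolvent in direction z is -R φ(z) R. As φ(z) commutes with R it
moves to the far left, where the functional turns it into the factor z: the derivative is complex
linear. -/
theorem differentiableAt_complexFunctional_resolventAt {φ : ℂ →ₐ[ℝ] A} {x : A}
    (hx : ∀ z, Commute (φ z) x) (l : A →L[ℝ] ℝ) (y : A) {u : ℂ} (hu : IsUnit (φ u + x)) :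
    DifferentiableAt ℂ (fun w => complexFunctional φ l (resolventAt φ x w * y)) u := by
  set R := resolventAt φ x u with hR
  let f : ℂ →L[ℝ] A := ⟨φ.toLinearMap, continuous_complexHom φ⟩
  have h1 : HasFDerivAt (fun w => φ w + x) f u := f.hasFDerivAt.add_const x
  obtain ⟨v, hv⟩ := hu
  have h2 := hasFDerivAt_ringInverse (𝕜 := ℝ) v
  rw [hv] at h2
  have h3 := ((complexFunctional φ l).hasFDerivAt.comp u
    ((((ContinuousLinearMap.mul ℝ A).flip y).hasFDerivAt).comp u (h2.comp u h1)))
  have hv' : (↑v⁻¹ : A) = R := by rw [hR, resolventAt, ← hv, Ring.inverse_unit]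
  refine (hasFDerivAt_of_restrictScalars ℝ
    (f' := (ContinuousLinearMap.toSpanSingleton ℂ (-complexFunctional φ l (R * R * y)))) h3
    ?_).differentiableAt
  refine ContinuousLinearMap.ext fun z => ?_
  have h4 : R * φ z * R * y = φ z * (R * R * y) := by
    rw [← (commute_complexHom_resolventAt hx u z).eq]; noncomm_ring
  have h5 : complexFunctional φ l (-(R * φ z * R) * y) = z * -complexFunctional φ l (R * R * y) := by
    rw [neg_mul, h4, map_neg, complexFunctional_smul, mul_neg]
  have h6 : f z = φ z := rfl
  simpa [hv', h6] using h5.symm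

theorem eventually_isUnit_add (φ : ℂ →ₐ[ℝ] A) (x : A) :
    ∀ᶠ u in cocompact ℂ, IsUnit (φ u + x) := by
  have h : ∀ᶠ u : ℂ in cocompact ℂ, IsUnit (1 + φ u⁻¹ * x) :=
    (tendsto_one_add_complexHom_inv φ x).eventually (Units.isOpen.mem_nhds isUnit_one)
  filter_upwards [h, eventually_ne_zero_cocompact] with u hu hu0
  rw [complexHom_mul_one_add φ x hu0]
  exact ((isUnit_iff_ne_zero.mpr hu0).map φ).mul hu

/-- For u ≠ 0 the resolvent factors as (1 + u⁻¹x)⁻¹ u⁻¹, and the first factor tends to 1. -/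
theorem tendsto_resolventAt {φ : ℂ →ₐ[ℝ] A} {x : A} (hx : ∀ z, Commute (φ z) x) :
    Tendsto (resolventAt φ x) (cocompact ℂ) (𝓝 0) := by
  have h1 : Tendsto (fun u : ℂ => Ring.inverse (1 + φ u⁻¹ * x)) (cocompact ℂ) (𝓝 1) := by
    have h := (NormedRing.inverse_continuousAt (1 : Aˣ)).tendsto
    rw [Units.val_one, Ring.inverse_one] at h
    exact h.comp (tendsto_one_add_complexHom_inv φ x)
  have h2 := h1.mul (tendsto_complexHom_inv φ)
  rw [mul_zero] at h2
  refine h2.congr' ?_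
  filter_upwards [eventually_ne_zero_cocompact] with u hu
  have h3 : Commute (φ u) (1 + φ u⁻¹ * x) :=
    (Commute.one_right _).add_right (((Commute.all _ _).map φ).mul_right (hx u))
  have h4 : φ u * φ u⁻¹ = 1 := by rw [← map_mul, mul_inv_cancel₀ hu, map_one]
  have h5 : φ u⁻¹ * φ u = 1 := by rw [← map_mul, inv_mul_cancel₀ hu, map_one]
  rw [resolventAt, complexHom_mul_one_add φ x hu, Ring.mul_inverse_rev' h3]
  congr 1
  exact (Ring.inverse_unit (⟨φ u, φ u⁻¹, h4, h5⟩ : Aˣ)).symm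

/-- If all complex functionals of `(φ(q(w)) + x)⁻¹ y` extend to entire functions, where `q` is entire
and proper, then `y` vanishes, by Liouville's theorem. -/
theorem eq_zero_of_entire_extension {φ : ℂ →ₐ[ℝ] A} {x : A} (hx : ∀ z, Commute (φ z) x) (y : A)
    (q : ℂ → ℂ) (hq : Differentiable ℂ q) (hq' : Tendsto q (cocompact ℂ) (cocompact ℂ))
    (H : (A →L[ℝ] ℝ) → ℂ → ℂ)
    (hH : ∀ l w, IsUnit (φ (q w) + x) →
      H l w = complexFunctional φ l (resolventAt φ x (q w) * y))
    (hd : ∀ l w, ¬ IsUnit (φ (q w) + x) → DifferentiableAt ℂ (H l) w) : y = 0 := by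
  have hU := eventually_isUnit_add φ x
  have hH0 : ∀ l, H l = 0 := by
    intro l
    refine Differentiable.eq_const_of_tendsto_cocompact (c := 0) (fun w => ?_) ?_
    · by_cases hw : IsUnit (φ (q w) + x)
      · have h1 := (differentiableAt_complexFunctional_resolventAt hx l y hw).comp w (hq w)
        refine h1.congr_of_eventuallyEq ?_
        filter_upwards [((isOpen_isUnit_add φ x).preimage hq.continuous).mem_nhds hw] with v hv
        exact hH l v hv
      · exact hd l w hw
    · have h1 : Tendsto (fun u => complexFunctional φ l (resolventAt φ x u * y))
          (cocompact ℂ) (𝓝 0) := by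
        have h2 := ((complexFunctional φ l).continuous.tendsto 0)
        rw [map_zero] at h2
        refine h2.comp ?_
        simpa using (tendsto_resolventAt hx).mul_const y
      refine (h1.comp hq').congr' ?_
      filter_upwards [hq'.eventually hU] with w hw
      exact (hH l w hw).symm
  -- Far out all values of q are regular; at one such point the vanishing of the product with the
  -- resolvent already gives y = 0.
  obtain ⟨w, hw⟩ := (hq'.eventually hU).exists
  have h1 : resolventAt φ x (q w) * y = 0 :=
    eq_zero_of_complexFunctional φ fun l => by rw [← hH l w hw, hH0 l]; rfl
  calc y = (φ (q w) + x) * (resolventAt φ x (q w) * y) := by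
        rw [← mul_assoc, resolventAt, Ring.mul_inverse_cancel _ hw, one_mul]
    _ = 0 := by rw [h1, mul_zero]

end Banach

/-! ### Gelfand theory: invertibility of z² + ∑ tᵢ² off the imaginary axis -/

section Gelfand

/-- Gelfand–Mazur: if x were no complex number, the resolvent of -x would be entire and vanish at
infinity, and Liouville with y = 1 would give 1 = 0. -/
theorem exists_eq_complexHom {F : Type*} [NormedCommRing F] [NormedAlgebra ℝ F] [CompleteSpace F]
    [Nontrivial F] (hF : ∀ x : F, x ≠ 0 → IsUnit x) (φ : ℂ →ₐ[ℝ] F) (x : F) :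
    ∃ z, x = φ z := by
  by_contra! h
  have hu : ∀ u, IsUnit (φ u + -x) := fun u => hF _ fun h0 =>
    h u (add_neg_eq_zero.mp h0).symm
  refine one_ne_zero (α := F) (eq_zero_of_entire_extension (φ := φ) (x := -x)
    (fun _ => Commute.all _ _) 1 id differentiable_id Filter.tendsto_id _
    (fun _ _ _ => rfl) fun l w hw => (hw (hu w)).elim)

/-- Modulo a maximal ideal the tᵢ become complex numbers wᵢ, real by `ht`. Then z² + ∑ wᵢ² = 0 makes
z² real, hence z real as Re z ≠ 0, and a sum of squares with z² > 0 cannot vanish. -/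
theorem isUnit_add_sum_sq_of_comm {M ι : Type*} [NormedCommRing M] [NormedAlgebra ℝ M]
    [CompleteSpace M] [Fintype ι] (φ : ℂ →ₐ[ℝ] M) (t : ι → M)
    (ht : ∀ i, ∀ a b : ℝ, b ≠ 0 → IsUnit ((t i - a • (1 : M)) ^ 2 + b ^ 2 • (1 : M)))
    {z : ℂ} (hz : z.re ≠ 0) : IsUnit (φ (z ^ 2) + ∑ i, t i ^ 2) := by
  by_contra hnu
  obtain ⟨m, hm, hmem⟩ := exists_max_ideal_of_mem_nonunits hnu
  have : Nontrivial (M ⧸ m) := Ideal.Quotient.nontrivial_iff.mpr hm.ne_top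
  have hF : ∀ x : M ⧸ m, x ≠ 0 → IsUnit x := fun x hx =>
    let := Ideal.Quotient.field m
    isUnit_iff_ne_zero.mpr hx
  let π : M →ₐ[ℝ] M ⧸ m := Ideal.Quotient.mkₐ ℝ m
  have h0 : π (φ (z ^ 2) + ∑ i, t i ^ 2) = 0 := Ideal.Quotient.eq_zero_iff_mem.mpr hmem
  choose w hw using fun i => exists_eq_complexHom hF (π.comp φ) (π (t i))
  have hreal : ∀ i, (w i).im = 0 := by
    intro i
    by_contra hi
    have h1 := (ht i (w i).re (w i).im hi).map π
    have h2 : π ((t i - (w i).re • (1 : M)) ^ 2 + (w i).im ^ 2 • (1 : M))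
        = (π.comp φ) ((w i - (w i).re • (1 : ℂ)) ^ 2 + (w i).im ^ 2 • (1 : ℂ)) := by
      simp only [map_add, map_sub, map_pow, map_smul, map_one, hw]
    have h3 : (w i - (w i).re • (1 : ℂ)) ^ 2 + (w i).im ^ 2 • (1 : ℂ) = 0 := by
      apply Complex.ext <;> simp [pow_two]
    rw [h2, h3, map_zero] at h1
    exact not_isUnit_zero h1
  have h4 : (π.comp φ) (z ^ 2 + ∑ i, w i ^ 2) = 0 := by
    rw [← h0]
    simp only [map_add, map_sum, map_pow, hw, AlgHom.comp_apply]
  have h5 : z ^ 2 + ∑ i, w i ^ 2 = 0 := by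
    by_contra h
    have := (isUnit_iff_ne_zero.mpr h).map (π.comp φ)
    rw [h4] at this
    exact not_isUnit_zero this
  have h6 := congrArg Complex.re h5
  have h7 := congrArg Complex.im h5
  simp [pow_two, hreal] at h6 h7
  have h8 : z.im = 0 := by
    have : z.re * z.im = 0 := by linarith
    simpa [hz] using this
  have h9 : 0 ≤ ∑ i, (w i).re * (w i).re := Finset.sum_nonneg fun i _ => mul_self_nonneg _
  rw [h8] at h6
  have := mul_self_pos.mpr hz
  linarith

/-- Whatever commutes with a unit commutes with its inverse, so centralizers are inverse-closed. -/
theorem isUnit_subtype_of_centralizer {A : Type*} [Ring A] [Algebra ℝ A] (s : Set A)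
    {x : Subalgebra.centralizer ℝ s} (hx : IsUnit (x : A)) : IsUnit x := by
  obtain ⟨v, hv⟩ := hx
  have h : (↑v⁻¹ : A) ∈ Subalgebra.centralizer ℝ s := by
    intro a ha
    have : Commute a (v : A) := hv ▸ x.2 a ha
    exact this.units_inv_right
  refine ⟨⟨x, ⟨_, h⟩, ?_, ?_⟩, rfl⟩
  · ext; simp [← hv]
  · ext; simp [← hv]

/-- Reduction to the commutative case through the bicommutant of φ(ℂ) and the tᵢ: it is closed,
hence complete, and inverse-closed, so the invertibility assumptions pass to it. -/
theorem isUnit_add_sum_sq {A ι : Type*} [NormedRing A] [NormedAlgebra ℝ A]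
    [CompleteSpace A] [Fintype ι] (φ : ℂ →ₐ[ℝ] A) (t : ι → A)
    (hφt : ∀ z i, Commute (φ z) (t i)) (htt : ∀ i k, Commute (t i) (t k))
    (ht : ∀ i, ∀ a b : ℝ, b ≠ 0 → IsUnit ((t i - a • (1 : A)) ^ 2 + b ^ 2 • (1 : A)))
    {z : ℂ} (hz : z.re ≠ 0) : IsUnit (φ (z ^ 2) + ∑ i, t i ^ 2) := by
  let S : Set A := range φ ∪ range t
  let C : Set A := Subalgebra.centralizer ℝ S
  let M := Subalgebra.centralizer ℝ C
  have hSS : S ⊆ C := by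
    rintro x (⟨z, rfl⟩ | ⟨i, rfl⟩) y (⟨w, rfl⟩ | ⟨k, rfl⟩)
    · exact (Commute.all w z).map φ
    · exact (hφt z k).symm
    · exact hφt w i
    · exact htt k i
  have hSM : S ⊆ M := fun x hx y hy => (hy x hx).symm
  -- The generators commute, so S ⊆ S'; hence S'' ⊆ S', and S'' is commutative.
  have hMC : ∀ x ∈ M, x ∈ C := fun x hx y hy => hx y (hSS hy)
  have hcomm : ∀ x y : M, x * y = y * x := fun x y => Subtype.ext (y.2 x (hMC x x.2))
  let : NormedCommRing M := { (inferInstance : NormedRing M) with mul_comm := hcomm }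
  have : CompleteSpace M := (Set.isClosed_centralizer C).completeSpace_coe
  let φ' : ℂ →ₐ[ℝ] M := φ.codRestrict M fun z => hSM (Or.inl ⟨z, rfl⟩)
  let t' : ι → M := fun i => ⟨t i, hSM (Or.inr ⟨i, rfl⟩)⟩
  have h := isUnit_add_sum_sq_of_comm φ' t'
    (fun i a b hb => isUnit_subtype_of_centralizer C (by simpa [t'] using ht i a b hb)) hz
  simpa [φ', t'] using h.map M.val

end Gelfand

/-! ### Integrability along piecewise C¹ curves and holomorphy of Cauchy-type integrals -/

section Curves

theorem IsPiecewiseC1Jordan.intervalIntegrable_deriv {γ : ℝ → ℂ} (h : IsPiecewiseC1Jordan γ) :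
    IntervalIntegrable (deriv γ) volume 0 1 := by
  obtain ⟨k, t, ht, h0, h1, hC⟩ := h.piecewise
  have key : ∀ i : Fin k, IntervalIntegrable (deriv γ) volume (t i.castSucc) (t i.succ) := by
    intro i
    have hlt : t i.castSucc < t i.succ := ht (Fin.castSucc_lt_succ)
    have hc : ContinuousOn (derivWithin γ (Icc (t i.castSucc) (t i.succ)))
        (Icc (t i.castSucc) (t i.succ)) :=
      (hC i).continuousOn_derivWithin (uniqueDiffOn_Icc hlt) le_rfl
    have hi := hc.intervalIntegrable_of_Icc (μ := volume) hlt.le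
    -- On the open piece `deriv` is the one-sided-compatible continuous derivative; its values at
    -- the break points do not affect the integral.
    refine hi.congr_uIoo fun s hs => ?_
    rw [uIoo_of_le hlt.le] at hs
    exact derivWithin_of_mem_nhds (Icc_mem_nhds hs.1 hs.2)
  have h2 : ∀ i : Fin (k + 1), IntervalIntegrable (deriv γ) volume 0 (t i) := by
    intro i
    induction i using Fin.induction with
    | zero => rw [h0]
    | succ i ih => exact ih.trans (key i)
  rw [← h1]
  exact h2 _

theorem differentiableAt_integral_div_sub {g p : ℝ → ℂ} (hg : IntervalIntegrable g volume 0 1)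
    (hp : ContinuousOn p (Icc 0 1)) {u : ℂ} (hu : u ∉ p '' Icc 0 1) :
    DifferentiableAt ℂ (fun v => ∫ t in (0 : ℝ)..1, g t / (p t - v)) u := by
  have hcl : IsClosed (p '' Icc 0 1) := (isCompact_Icc.image_of_continuousOn hp).isClosed
  obtain ⟨δ, hδ, hball⟩ := Metric.isOpen_iff.mp hcl.isOpen_compl u hu
  -- Half the distance δ keeps the denominators bounded below uniformly near u, which yields the
  -- dominating function for differentiation under the integral.
  have hsep : ∀ t ∈ Icc (0 : ℝ) 1, ∀ v ∈ Metric.ball u (δ / 2), δ / 2 ≤ ‖p t - v‖ := by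
    intro t ht v hv
    have h1 : δ ≤ dist (p t) u := by
      by_contra! h
      exact hball h ⟨t, ht, rfl⟩
    have h2 := dist_triangle (p t) v u
    rw [Metric.mem_ball] at hv
    rw [← dist_eq_norm]; linarith
  have hne : ∀ t ∈ Icc (0 : ℝ) 1, ∀ v ∈ Metric.ball u (δ / 2), p t - v ≠ 0 := fun t ht v hv h0 => by
    have := hsep t ht v hv
    rw [h0, norm_zero] at this; linarith
  have hint : ∀ v ∈ Metric.ball u (δ / 2), ∀ n : ℕ,
      IntervalIntegrable (fun t => g t * ((p t - v) ^ n)⁻¹) volume 0 1 := by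
    intro v hv n
    refine hg.mul_continuousOn ?_
    rw [uIcc_of_le zero_le_one]
    exact ((hp.sub continuousOn_const).pow n).inv₀ fun t ht => pow_ne_zero n (hne t ht v hv)
  have hmem : Metric.ball u (δ / 2) ∈ 𝓝 u := Metric.ball_mem_nhds u (half_pos hδ)
  have hIoc : ∀ t ∈ Ι (0 : ℝ) 1, t ∈ Icc (0 : ℝ) 1 := fun t ht =>
    Ioc_subset_Icc_self (by rwa [uIoc_of_le zero_le_one] at ht)
  have hF : ∀ v ∈ Metric.ball u (δ / 2), IntervalIntegrable (fun t => g t / (p t - v)) volume 0 1 :=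
    fun v hv => by simpa [div_eq_mul_inv] using hint v hv 1
  refine (intervalIntegral.hasDerivAt_integral_of_dominated_loc_of_deriv_le
    (F := fun v t => g t / (p t - v)) (F' := fun v t => g t * ((p t - v) ^ 2)⁻¹)
    (bound := fun t => ‖g t‖ * ((δ / 2) ^ 2)⁻¹) hmem ?_ (hF u (mem_of_mem_nhds hmem)) ?_ ?_ ?_
    ?_).2.differentiableAt
  · filter_upwards [hmem] with v hv
    exact (intervalIntegrable_iff.mp (hF v hv)).aestronglyMeasurable
  · exact (intervalIntegrable_iff.mp (hint u (mem_of_mem_nhds hmem) 2)).aestronglyMeasurable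
  · refine Eventually.of_forall fun t ht v hv => ?_
    rw [norm_mul, norm_inv, norm_pow]
    have := hsep t (hIoc t ht) v hv
    have := half_pos hδ
    gcongr
  · exact hg.norm.mul_const _
  · refine Eventually.of_forall fun t ht v hv => ?_
    have h1 : HasDerivAt (fun v => p t - v) (-1) v := by
      simpa using (hasDerivAt_id v).const_sub (p t)
    have h2 := (h1.inv (hne t (hIoc t ht) v hv)).const_mul (g t)
    simpa [div_eq_mul_inv] using h2

end Curves

/-! ### Riesz projections and their Cauchy transforms along cycles -/

section Cycles

variable {A : Type*} [NormedRing A] [NormedAlgebra ℝ A]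

/-- A finite family of continuous curves on `[0, 1]` with integrable derivatives. -/
structure IsCycle {m : ℕ} (γ : Fin m → ℝ → ℂ) : Prop where
  continuousOn : ∀ j, ContinuousOn (γ j) (Icc 0 1)
  integrable : ∀ j, IntervalIntegrable (deriv (γ j)) volume 0 1

/-- The set of the points on the curves of a family. -/
def trace {m : ℕ} (γ : Fin m → ℝ → ℂ) : Set ℂ := ⋃ j, γ j '' Icc 0 1

theorem IsOrientedBoundary.isCycle {D : Set ℂ} {m : ℕ} {γ : Fin m → ℝ → ℂ}
    (h : IsOrientedBoundary D γ) : IsCycle γ :=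
  ⟨fun j => (h.jordan j).continuousOn, fun j => (h.jordan j).intervalIntegrable_deriv⟩

/-- The mean of the winding numbers of a family of curves about `w` and `-w`. -/
def meanWinding {m : ℕ} (γ : Fin m → ℝ → ℂ) (w : ℂ) : ℂ :=
  (∑ j, winding (γ j) w + ∑ j, winding (γ j) (-w)) / 2

/-- The integral `(2πi)⁻¹ ∫_γ f(z) dz`. -/
def cycleIntegral (φ : ℂ →ₐ[ℝ] A) {m : ℕ} (γ : Fin m → ℝ → ℂ) (f : ℂ → A) : A :=
  φ (2 * Real.pi * Complex.I)⁻¹ * ∑ j, ∫ t in (0 : ℝ)..1, φ (deriv (γ j) t) * f (γ j t)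

variable {m : ℕ} {γ : Fin m → ℝ → ℂ}

theorem mem_trace (j : Fin m) {t : ℝ} (ht : t ∈ Icc (0 : ℝ) 1) : γ j t ∈ trace γ :=
  mem_iUnion.mpr ⟨j, t, ht, rfl⟩

theorem IsCycle.intervalIntegrable (h : IsCycle γ) (φ : ℂ →ₐ[ℝ] A) {f : ℂ → A}
    (hf : ContinuousOn f (trace γ)) (j : Fin m) :
    IntervalIntegrable (fun t => φ (deriv (γ j) t) * f (γ j t)) volume 0 1 := by
  let F : ℂ →L[ℝ] A := ⟨φ.toLinearMap, continuous_complexHom φ⟩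
  have h1 : IntervalIntegrable (fun t => φ (deriv (γ j) t)) volume 0 1 :=
    ⟨F.integrable_comp (h.integrable j).1, F.integrable_comp (h.integrable j).2⟩
  refine h1.mul_continuousOn ?_
  rw [uIcc_of_le zero_le_one]
  exact hf.comp (h.continuousOn j) fun t ht => mem_trace j ht

theorem sq_sub_sq_ne_zero {w z : ℂ} (hw : w ∉ trace γ) (hw' : -w ∉ trace γ) (hz : z ∈ trace γ) :
    z ^ 2 - w ^ 2 ≠ 0 := by
  intro h0
  rcases sq_eq_sq_iff_eq_or_eq_neg.mp (sub_eq_zero.mp h0) with h | h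
  · exact hw (h ▸ hz)
  · exact hw' (h ▸ hz)

theorem continuousOn_div_sq_sub_sq {w : ℂ} (hw : w ∉ trace γ) (hw' : -w ∉ trace γ) :
    ContinuousOn (fun z => z / (z ^ 2 - w ^ 2)) (trace γ) :=
  continuousOn_id.div (by fun_prop) fun _ hz => sq_sub_sq_ne_zero hw hw' hz

theorem IsCycle.cycleIntegral_sub (h : IsCycle γ) (φ : ℂ →ₐ[ℝ] A) {f g : ℂ → A}
    (hf : ContinuousOn f (trace γ)) (hg : ContinuousOn g (trace γ)) :
    cycleIntegral φ γ (fun z => f z - g z) = cycleIntegral φ γ f - cycleIntegral φ γ g := by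
  rw [cycleIntegral, cycleIntegral, cycleIntegral, ← mul_sub, ← Finset.sum_sub_distrib]
  congr 1
  refine Finset.sum_congr rfl fun j _ => ?_
  rw [← intervalIntegral.integral_sub (h.intervalIntegrable φ hf j) (h.intervalIntegrable φ hg j)]
  simp only [mul_sub]

theorem cycleIntegral_congr (φ : ℂ →ₐ[ℝ] A) {f g : ℂ → A} (hfg : EqOn f g (trace γ)) :
    cycleIntegral φ γ f = cycleIntegral φ γ g := by
  rw [cycleIntegral, cycleIntegral]
  congr 1
  refine Finset.sum_congr rfl fun j _ => intervalIntegral.integral_congr fun t ht => ?_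
  rw [uIcc_of_le zero_le_one] at ht
  simp only [hfg (mem_trace j ht)]

variable [CompleteSpace A]

theorem complexHom_integral (φ : ℂ →ₐ[ℝ] A) {f : ℝ → ℂ} (hf : IntervalIntegrable f volume 0 1) :
    ∫ t in (0 : ℝ)..1, φ (f t) = φ (∫ t in (0 : ℝ)..1, f t) := by
  let F : ℂ →L[ℝ] A := ⟨φ.toLinearMap, continuous_complexHom φ⟩
  exact F.intervalIntegral_comp_comm hf

theorem integral_mul_const_of_intervalIntegrable {f : ℝ → A} (hf : IntervalIntegrable f volume 0 1)
    (y : A) : ∫ t in (0 : ℝ)..1, f t * y = (∫ t in (0 : ℝ)..1, f t) * y :=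
  ((ContinuousLinearMap.mul ℝ A).flip y).intervalIntegral_comp_comm hf

theorem IsCycle.cycleIntegral_mul (h : IsCycle γ) (φ : ℂ →ₐ[ℝ] A) {f : ℂ → A}
    (hf : ContinuousOn f (trace γ)) (y : A) :
    cycleIntegral φ γ (fun z => f z * y) = cycleIntegral φ γ f * y := by
  simp only [cycleIntegral]
  rw [mul_assoc (φ _), Finset.sum_mul]
  congr 1
  refine Finset.sum_congr rfl fun j _ => ?_
  rw [← integral_mul_const_of_intervalIntegrable (h.intervalIntegrable φ hf j)]
  simp only [mul_assoc]

theorem IsCycle.commute_cycleIntegral (h : IsCycle γ) (φ : ℂ →ₐ[ℝ] A) {f : ℂ → A}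
    (hf : ContinuousOn f (trace γ)) {y : A} (hφ : ∀ z, Commute (φ z) y)
    (hy : ∀ z, Commute (f z) y) : Commute (cycleIntegral φ γ f) y := by
  refine (hφ _).mul_left (Commute.sum_left _ _ _ fun j _ => ?_)
  have h1 := integral_mul_const_of_intervalIntegrable (h.intervalIntegrable φ hf j) y
  have h2 := (ContinuousLinearMap.mul ℝ A y).intervalIntegral_comp_comm
    (h.intervalIntegrable φ hf j)
  refine h1.symm.trans (Eq.trans ?_ h2)
  congr 1
  ext t
  exact ((hφ _).mul_left (hy _)).eq

/-- Partial fractions: 2z/(z² - w²) = 1/(z - w) + 1/(z + w). This is why the mean of the two winding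
numbers appears. -/
theorem IsCycle.cycleIntegral_div_sq_sub_sq (h : IsCycle γ) (φ : ℂ →ₐ[ℝ] A) {w : ℂ}
    (hw : w ∉ trace γ) (hw' : -w ∉ trace γ) :
    cycleIntegral φ γ (fun z => φ (z / (z ^ 2 - w ^ 2))) = φ (meanWinding γ w) := by
  have hint : ∀ {v : ℂ}, v ∉ trace γ → ∀ j,
      IntervalIntegrable (fun t => deriv (γ j) t / (γ j t - v)) volume 0 1 := by
    intro v hv j
    have hc : ContinuousOn (fun z => (z - v)⁻¹) (trace γ) :=
      ContinuousOn.inv₀ (by fun_prop) fun z hz h0 => hv (sub_eq_zero.mp h0 ▸ hz)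
    simpa [div_eq_mul_inv] using h.intervalIntegrable (AlgHom.id ℝ ℂ) hc j
  have key : ∀ j, ∫ t in (0 : ℝ)..1, φ (deriv (γ j) t) * φ (γ j t / (γ j t ^ 2 - w ^ 2))
      = φ (((∫ t in (0 : ℝ)..1, deriv (γ j) t / (γ j t - w))
        + ∫ t in (0 : ℝ)..1, deriv (γ j) t / (γ j t - -w)) / 2) := by
    intro j
    rw [← intervalIntegral.integral_add (hint hw j) (hint hw' j), ← intervalIntegral.integral_div,
      ← complexHom_integral φ (((hint hw j).add (hint hw' j)).div_const 2)]
    refine intervalIntegral.integral_congr fun t ht => ?_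
    rw [uIcc_of_le zero_le_one] at ht
    have h1 : γ j t - w ≠ 0 := fun h0 => hw (sub_eq_zero.mp h0 ▸ mem_trace j ht)
    have h2 : γ j t - -w ≠ 0 := fun h0 => hw' (sub_eq_zero.mp h0 ▸ mem_trace j ht)
    have h3 : γ j t ^ 2 - w ^ 2 = (γ j t - w) * (γ j t - -w) := by ring
    simp only [← map_mul]
    rw [h3]
    congr 1
    field_simp
    ring
  rw [cycleIntegral, Finset.sum_congr rfl fun j _ => key j, ← map_sum, ← map_mul, meanWinding]
  congr 1
  simp only [winding, ← Finset.mul_sum, ← Finset.sum_div, Finset.sum_add_distrib]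
  ring

variable (φ : ℂ →ₐ[ℝ] A) (x : A)

/-- The operator `(2πi)⁻¹ ∫_γ z (z² + x)⁻¹ dz`. -/
def rieszProj (γ : Fin m → ℝ → ℂ) : A :=
  cycleIntegral φ γ fun z => φ z * resolventAt φ x (z ^ 2)

/-- The operator `(2πi)⁻¹ ∫_γ z (z² - w²)⁻¹ (z² + x)⁻¹ dz`. -/
def rieszCauchy (γ : Fin m → ℝ → ℂ) (w : ℂ) : A :=
  cycleIntegral φ γ fun z => φ (z / (z ^ 2 - w ^ 2)) * resolventAt φ x (z ^ 2)

variable {φ x}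

theorem continuousOn_resolventAt_sq (hγ : ∀ z ∈ trace γ, IsUnit (φ (z ^ 2) + x)) :
    ContinuousOn (fun z => resolventAt φ x (z ^ 2)) (trace γ) := fun z hz =>
  ((continuousAt_resolventAt (hγ z hz)).comp (f := fun z : ℂ => z ^ 2)
    (by fun_prop)).continuousWithinAt

/-- By the resolvent identity R(z²) - R(w²) = (w² - z²) R(z²) R(w²). The factor w² - z² cancels the
kernel's denominator and leaves -z R(z²) R(w²), which integrates to -P R(w²). -/
theorem IsCycle.rieszCauchy_eq (h : IsCycle γ) (hx : ∀ z, Commute (φ z) x)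
    (hγ : ∀ z ∈ trace γ, IsUnit (φ (z ^ 2) + x)) {w : ℂ} (hw : w ∉ trace γ) (hw' : -w ∉ trace γ)
    (hwu : IsUnit (φ (w ^ 2) + x)) :
    rieszCauchy φ x γ w
      = (φ (meanWinding γ w) - rieszProj φ x γ) * resolventAt φ x (w ^ 2) := by
  have hR := continuousOn_resolventAt_sq hγ
  have hd : ContinuousOn (fun z => φ (z / (z ^ 2 - w ^ 2))) (trace γ) :=
    (continuous_complexHom φ).comp_continuousOn (continuousOn_div_sq_sub_sq hw hw')
  have hz : ContinuousOn (fun z => φ z * resolventAt φ x (z ^ 2)) (trace γ) :=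
    (continuous_complexHom φ).continuousOn.mul hR
  rw [sub_mul, ← h.cycleIntegral_div_sq_sub_sq φ hw hw', rieszProj, ← h.cycleIntegral_mul φ hd,
    ← h.cycleIntegral_mul φ hz, rieszCauchy,
    ← h.cycleIntegral_sub φ (f := fun z => φ (z / (z ^ 2 - w ^ 2)) * resolventAt φ x (w ^ 2))
      (g := fun z => φ z * resolventAt φ x (z ^ 2) * resolventAt φ x (w ^ 2))
      (hd.mul continuousOn_const) (hz.mul continuousOn_const)]
  refine cycleIntegral_congr φ fun z hzt => ?_
  have h1 := resolventAt_sub hx (hγ z hzt) hwu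
  have h2 : z / (z ^ 2 - w ^ 2) * (w ^ 2 - z ^ 2) = -z := by
    have := sq_sub_sq_ne_zero hw hw' hzt
    field_simp
    ring
  have h3 : φ (z / (z ^ 2 - w ^ 2)) * (resolventAt φ x (z ^ 2) - resolventAt φ x (w ^ 2))
      = -(φ z * resolventAt φ x (z ^ 2) * resolventAt φ x (w ^ 2)) := by
    rw [h1, ← mul_assoc, ← map_mul, h2, map_neg, neg_mul, mul_assoc]
  rw [mul_sub, sub_eq_iff_eq_add] at h3
  simp only [h3]
  abel

/-- Invertibility of w² + x is not needed. After the functional is applied, this is a Cauchy-type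
integral with denominator γ² - u, composed with u = v². -/
theorem IsCycle.differentiableAt_rieszCauchy (h : IsCycle γ)
    (hγ : ∀ z ∈ trace γ, IsUnit (φ (z ^ 2) + x)) (l : A →L[ℝ] ℝ) (y : A) {w : ℂ}
    (hw : w ∉ trace γ) (hw' : -w ∉ trace γ) :
    DifferentiableAt ℂ (fun v => complexFunctional φ l (rieszCauchy φ x γ v * y)) w := by
  have hcl : IsClosed (trace γ) := isClosed_iUnion_of_finite fun j =>
    (isCompact_Icc.image_of_continuousOn (h.continuousOn j)).isClosed
  let g : Fin m → ℝ → ℂ := fun j t => deriv (γ j) t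
    * (γ j t * complexFunctional φ l (resolventAt φ x (γ j t ^ 2) * y))
  have hR : ContinuousOn (fun z => z * complexFunctional φ l (resolventAt φ x (z ^ 2) * y))
      (trace γ) := continuousOn_id.mul
    ((complexFunctional φ l).continuous.comp_continuousOn
      ((continuousOn_resolventAt_sq hγ).mul continuousOn_const))
  have hg : ∀ j, IntervalIntegrable (g j) volume 0 1 := fun j =>
    h.intervalIntegrable (AlgHom.id ℝ ℂ) hR j
  have hd : ∀ j, DifferentiableAt ℂ
      (fun v : ℂ => ∫ t in (0 : ℝ)..1, g j t / (γ j t ^ 2 - v ^ 2)) w := by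
    intro j
    refine (differentiableAt_integral_div_sub (hg j) ((h.continuousOn j).pow 2) ?_).comp
      (f := fun v : ℂ => v ^ 2) w (by fun_prop)
    rintro ⟨t, ht, h0⟩
    exact sq_sub_sq_ne_zero hw hw' (mem_trace j ht) (sub_eq_zero.mpr h0)
  have hs : DifferentiableAt ℂ (fun v : ℂ => (2 * Real.pi * Complex.I)⁻¹
      * ∑ j, ∫ t in (0 : ℝ)..1, g j t / (γ j t ^ 2 - v ^ 2)) w :=
    (DifferentiableAt.fun_sum fun j _ => hd j).const_mul _
  refine hs.congr_of_eventuallyEq ?_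
  filter_upwards [hcl.isOpen_compl.mem_nhds hw,
    (hcl.isOpen_compl.preimage continuous_neg).mem_nhds hw'] with v hv hv'
  have hc : ContinuousOn (fun z => φ (z / (z ^ 2 - v ^ 2)) * resolventAt φ x (z ^ 2))
      (trace γ) := ((continuous_complexHom φ).comp_continuousOn
        (continuousOn_div_sq_sub_sq hv hv')).mul (continuousOn_resolventAt_sq hγ)
  rw [rieszCauchy, ← h.cycleIntegral_mul φ hc, cycleIntegral, complexFunctional_smul, map_sum]
  congr 1
  refine Finset.sum_congr rfl fun j _ => ?_
  rw [← (complexFunctional φ l).intervalIntegral_comp_comm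
    (h.intervalIntegrable φ (f := fun z => φ (z / (z ^ 2 - v ^ 2)) * resolventAt φ x (z ^ 2) * y)
      (hc.mul continuousOn_const) j)]
  congr 1
  ext t
  simp only [mul_assoc, complexFunctional_smul, g]
  ring

theorem tendsto_sq_cocompact : Tendsto (fun w : ℂ => w ^ 2) (cocompact ℂ) (cocompact ℂ) := by
  rw [← Metric.cobounded_eq_cocompact, ← tendsto_norm_atTop_iff_cobounded]
  simp only [norm_pow]
  exact (tendsto_pow_atTop two_ne_zero).comp tendsto_norm_cobounded_atTop

/-- If `(w² + x)⁻¹ y` has holomorphic extensions near all points of its singular set, then `y`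
vanishes, by Liouville's theorem. -/
theorem eq_zero_of_local_extension (hx : ∀ z, Commute (φ z) x) (y : A) (D : ℂ → A)
    (hD : ∀ w, ¬ IsUnit (φ (w ^ 2) + x) →
      (∀ᶠ v in 𝓝 w, IsUnit (φ (v ^ 2) + x) → resolventAt φ x (v ^ 2) * y = D v) ∧
      ∀ l, DifferentiableAt ℂ (fun v => complexFunctional φ l (D v)) w) : y = 0 := by
  classical
  refine eq_zero_of_entire_extension hx y (fun w => w ^ 2) (by fun_prop) tendsto_sq_cocompact
    (fun l w => if IsUnit (φ (w ^ 2) + x) then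
      complexFunctional φ l (resolventAt φ x (w ^ 2) * y) else complexFunctional φ l (D w))
    (fun l w hw => if_pos hw) fun l w hw => ?_
  obtain ⟨h1, h2⟩ := hD w hw
  refine (h2 l).congr_of_eventuallyEq ?_
  filter_upwards [h1] with v hv
  split_ifs with hu
  · rw [hv hu]
  · rfl

theorem IsCycle.commute_rieszProj (h : IsCycle γ)
    (hγ : ∀ z ∈ trace γ, IsUnit (φ (z ^ 2) + x)) {y : A} (hφ : ∀ z, Commute (φ z) y)
    (hy : Commute x y) : Commute (rieszProj φ x γ) y :=
  h.commute_cycleIntegral φ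
    ((continuous_complexHom φ).continuousOn.mul (continuousOn_resolventAt_sq hγ)) hφ
    fun z => (hφ z).mul_left (commute_resolventAt hφ hy _)

/-- The function R(w²)(P - P²) extends across each singular w because the mean winding number is
locally a constant c ∈ {0, 1} there. -/
theorem IsCycle.rieszProj_mul_self (h : IsCycle γ) (hx : ∀ z, Commute (φ z) x)
    (hγ : ∀ z ∈ trace γ, IsUnit (φ (z ^ 2) + x))
    (hK : ∀ w, ¬ IsUnit (φ (w ^ 2) + x) → ∃ c : ℂ, c * (1 - c) = 0 ∧
      ∀ᶠ v in 𝓝 w, v ∉ trace γ ∧ -v ∉ trace γ ∧ meanWinding γ v = c) :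
    rieszProj φ x γ * rieszProj φ x γ = rieszProj φ x γ := by
  set P := rieszProj φ x γ
  have hφP : ∀ z, Commute (φ z) P := fun z =>
    (h.commute_rieszProj hγ (fun w => (Commute.all w z).map φ) (hx z).symm).symm
  have hxP : Commute x P := (h.commute_rieszProj hγ hx (Commute.refl x)).symm
  have hRP : ∀ u, Commute (resolventAt φ x u) P := commute_resolventAt hφP hxP
  refine (sub_eq_zero.mp (eq_zero_of_local_extension hx (P - P * P)
    (fun v => rieszCauchy φ x γ v * (P + φ (meanWinding γ v) - 1)) fun w hw => ?_)).symm
  obtain ⟨c, hc, hcw⟩ := hK w hw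
  refine ⟨?_, fun l => ?_⟩
  · filter_upwards [hcw] with v ⟨hv, hv', hvc⟩ hu
    have h1 : φ c * φ c = φ c := by
      rw [← map_mul]; congr 1; linear_combination -hc
    have h2 : Commute (φ c - P) (resolventAt φ x (v ^ 2)) :=
      (commute_complexHom_resolventAt hx _ c).sub_left (hRP _).symm
    -- This factorization, valid as c² = c, treats inside and outside at once: for c = 1 it reads (1
    -- - P)P, for c = 0 it reads -P(P - 1).
    have h3 : (φ c - P) * (P + φ c - 1) = P - P * P := by
      simp only [sub_mul, mul_sub, mul_add, mul_one, h1, (hφP c).eq]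
      abel
    rw [h.rieszCauchy_eq hx hγ hv hv' hu, hvc, h2.eq, mul_assoc, h3]
  · have h0 := hcw.self_of_nhds
    refine (h.differentiableAt_rieszCauchy hγ l (P + φ c - 1) h0.1 h0.2.1).congr_of_eventuallyEq ?_
    filter_upwards [hcw] with v hv
    rw [hv.2.2]

/-- Subtracting the two Cauchy transforms cancels the equal winding terms and leaves R(w²)(P_γ -
P_γ'). -/
theorem rieszProj_eq {m' : ℕ} {γ' : Fin m' → ℝ → ℂ} (h : IsCycle γ) (h' : IsCycle γ')
    (hx : ∀ z, Commute (φ z) x) (hγ : ∀ z ∈ trace γ, IsUnit (φ (z ^ 2) + x))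
    (hγ' : ∀ z ∈ trace γ', IsUnit (φ (z ^ 2) + x))
    (hK : ∀ w, ¬ IsUnit (φ (w ^ 2) + x) → ∀ᶠ v in 𝓝 w, (v ∉ trace γ ∧ -v ∉ trace γ) ∧
      (v ∉ trace γ' ∧ -v ∉ trace γ') ∧ meanWinding γ v = meanWinding γ' v) :
    rieszProj φ x γ = rieszProj φ x γ' := by
  have hφP : ∀ {k : ℕ} {δ : Fin k → ℝ → ℂ}, IsCycle δ →
      (∀ z ∈ trace δ, IsUnit (φ (z ^ 2) + x)) → ∀ u,
      Commute (resolventAt φ x u) (rieszProj φ x δ) := fun hδ hδu =>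
    commute_resolventAt (fun z => (hδ.commute_rieszProj hδu
      (fun w => (Commute.all w z).map φ) (hx z).symm).symm)
      (hδ.commute_rieszProj hδu hx (Commute.refl x)).symm
  refine sub_eq_zero.mp (eq_zero_of_local_extension hx _
    (fun v => rieszCauchy φ x γ' v * 1 - rieszCauchy φ x γ v * 1) fun w hw => ⟨?_, fun l => ?_⟩)
  · filter_upwards [hK w hw] with v hv hu
    rw [h.rieszCauchy_eq hx hγ hv.1.1 hv.1.2 hu, h'.rieszCauchy_eq hx hγ' hv.2.1.1 hv.2.1.2 hu,
      hv.2.2, mul_sub, (hφP h hγ _).eq, (hφP h' hγ' _).eq]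
    noncomm_ring
  · have h0 := (hK w hw).self_of_nhds
    simp only [map_sub]
    exact (h'.differentiableAt_rieszCauchy hγ' l 1 h0.2.1.1 h0.2.1.2).sub
      (h.differentiableAt_rieszCauchy hγ l 1 h0.1.1 h0.1.2)

end Cycles

/-! ### Clifford operators: T² = -∑ Tᵢ² and the singular set on a slice -/

section Operators

variable {n : ℕ} {V : Type*} [NormedAddCommGroup V] [NormedSpace ℝ V]

theorem norm_slicePoint (I : UnitVec n) (z : ℂ) : ‖slicePoint I z‖ ^ 2 = z.re ^ 2 + z.im ^ 2 := by
  rw [WithLp.prod_norm_sq_eq_of_L2]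
  have hI : ‖(I : EuclideanSpace ℝ (Fin n))‖ = 1 := by simp
  simp [slicePoint, norm_smul, hI]

theorem negSq_unitVec (I : UnitVec n) :
    negSq n ((I : EuclideanSpace ℝ (Fin n)) : Fin n → ℝ) = -1 := by
  have hI : ‖(I : EuclideanSpace ℝ (Fin n))‖ = 1 := by simp
  have h := EuclideanSpace.norm_sq_eq (I : EuclideanSpace ℝ (Fin n))
  rw [hI] at h
  simp only [Real.norm_eq_abs, sq_abs] at h
  simp [QuadraticMap.weightedSumSquares_apply, ← pow_two, ← h]

/-- The embedding of the complex numbers onto the plane `ℂ_I` in the Clifford algebra. -/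
def sliceHom (I : UnitVec n) : ℂ →ₐ[ℝ] Cl n :=
  Complex.lift ⟨CliffordAlgebra.ι (negSq n) ((I : EuclideanSpace ℝ (Fin n)) : Fin n → ℝ), by
    rw [CliffordAlgebra.ι_sq_scalar, negSq_unitVec, map_neg, map_one]⟩

theorem toCl_slicePoint (I : UnitVec n) (z : ℂ) : (slicePoint I z).toCl = sliceHom I z := by
  rw [sliceHom, Complex.lift_apply, Complex.liftAux_apply, Para.toCl, slicePoint]
  congr 1
  exact map_smul (CliffordAlgebra.ι (negSq n)) _ _

/-- The embedding of the complex numbers into `B(Vₙ)` as left multiplications by elements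
of `ℂ_I`. -/
def sliceScalar (V : Type*) [NormedAddCommGroup V] [NormedSpace ℝ V] (I : UnitVec n) :
    ℂ →ₐ[ℝ] CliffordOp n V := scalar.comp (sliceHom I)

theorem leftGen_ext (S : V →L[ℝ] V) (k : Fin n) :
    (ext S : CMod n V →L[ℝ] CMod n V) * leftGen k = leftGen k * ext S := by
  ext v B
  simp [ext_apply, leftGen_apply]

theorem commute_scalar_comp (a : Cl n) (S : V →L[ℝ] V) : Commute (scalar a) (comp S) := by
  refine Subtype.ext ?_
  change leftMul (V := V) a * ext S = ext S * leftMul (V := V) a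
  induction a using CliffordAlgebra.induction with
  | algebraMap r => rw [AlgHom.commutes]; exact Algebra.commutes r _
  | ι x =>
    rw [leftMul, CliffordAlgebra.lift_ι_apply, Fintype.linearCombination_apply,
      Finset.sum_mul, Finset.mul_sum]
    refine Finset.sum_congr rfl fun i _ => ?_
    rw [smul_mul_assoc, mul_smul_comm, leftGen_ext]
  | mul a b ha hb => rw [map_mul, mul_assoc, hb, ← mul_assoc, ha, mul_assoc]
  | add a b ha hb => rw [map_add, add_mul, mul_add, ha, hb]

/-- The embedding of the bounded operators on `V` into `B(Vₙ)`. -/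
def compHom : (V →L[ℝ] V) →ₐ[ℝ] CliffordOp n V where
  toFun := comp
  map_one' := rfl
  map_mul' _ _ := rfl
  map_zero' := rfl
  map_add' _ _ := rfl
  commutes' _ := rfl

theorem compHom_apply (S : V →L[ℝ] V) : compHom (n := n) S = comp S := rfl

theorem gen_sq (i : Fin n) : gen i * gen i = (-1 : Cl n) := by
  rw [gen, CliffordAlgebra.ι_sq_scalar]
  simp [QuadraticMap.weightedSumSquares_apply, Pi.single_apply]

theorem gen_anticomm {i k : Fin n} (h : i ≠ k) : gen i * gen k = -(gen k * gen i : Cl n) := by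
  have hQ : QuadraticMap.polar (negSq n) (Pi.single i 1) (Pi.single k 1) = 0 := by
    simp only [QuadraticMap.polar, QuadraticMap.weightedSumSquares_apply,
      ← Finset.sum_sub_distrib]
    refine Finset.sum_eq_zero fun j _ => ?_
    by_cases hi : j = i
    · subst hi; simp [h]
    · simp [hi]
  rw [eq_neg_iff_add_eq_zero, gen, gen, CliffordAlgebra.ι_mul_ι_add_swap, hQ, map_zero]

/-- The sum `∑ Tᵢ²` as an element of `B(Vₙ)`. -/
def ParaOp.imSq (T : ParaOp n V) : CliffordOp n V := ∑ i, comp (T.im i) ^ 2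

theorem ParaOp.commute_comp_im (T : ParaOp n V) (i k : Fin n) :
    Commute (comp (n := n) (T.im i)) (comp (T.im k)) := (T.commute_im i k).map compHom

theorem ParaOp.commute_scalar_imSq (T : ParaOp n V) (a : Cl n) : Commute (scalar a) T.imSq :=
  Commute.sum_right _ _ _ fun i _ => (commute_scalar_comp a (T.im i)).pow_right 2

/-- Adding the double sum to its transpose kills the off-diagonal terms by anticommutation, as the
tᵢ commute; the factor 2 is then cancelled. -/
theorem sum_mul_mul_sum_eq {A : Type*} [Ring A] [Algebra ℝ A] (g t : Fin n → A)
    (hg : ∀ i, g i * g i = -1) (hgg : ∀ i k, i ≠ k → g i * g k = -(g k * g i))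
    (hgt : ∀ i k, Commute (g i) (t k)) (htt : ∀ i k, Commute (t i) (t k)) :
    (∑ i, g i * t i) * (∑ i, g i * t i) = -∑ i, t i ^ 2 := by
  have h1 : (∑ i, g i * t i) * (∑ i, g i * t i) = ∑ i, ∑ k, g i * g k * (t i * t k) := by
    rw [Finset.sum_mul_sum]
    exact Finset.sum_congr rfl fun i _ => Finset.sum_congr rfl fun k _ =>
      ((hgt k i).symm.mul_mul_mul_comm _ _)
  have h2 : (∑ i, g i * t i) * (∑ i, g i * t i) = ∑ i, ∑ k, g k * g i * (t i * t k) := by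
    rw [h1, Finset.sum_comm]
    refine Finset.sum_congr rfl fun i _ => Finset.sum_congr rfl fun k _ => ?_
    rw [(htt k i).eq]
  have h3 : ∀ i k, g i * g k * (t i * t k) + g k * g i * (t i * t k)
      = if i = k then (2 : ℝ) • -(t i ^ 2) else 0 := by
    intro i k
    split_ifs with hik
    · subst hik
      rw [hg, two_smul, neg_one_mul, pow_two]
    · rw [hgg i k hik, neg_mul, neg_add_cancel]
  refine smul_right_injective A (two_ne_zero' ℝ) ?_
  simp only [two_smul]
  nth_rewrite 1 [h1]
  rw [h2, ← Finset.sum_add_distrib]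
  simp_rw [← Finset.sum_add_distrib, h3]
  simp [two_smul, Finset.sum_add_distrib]

theorem ParaOp.op_eq_sum (T : ParaOp n V) (hT0 : T.re = 0) :
    T.op = ∑ i, scalar (gen i) * comp (T.im i) := by
  rw [ParaOp.op, hT0]
  exact zero_add (M := CliffordOp n V) _

theorem ParaOp.conj_eq_neg (T : ParaOp n V) (hT0 : T.re = 0) : T.conj = -T.op := by
  rw [T.op_eq_sum hT0, ParaOp.conj, hT0]
  exact zero_sub (G := CliffordOp n V) _

theorem ParaOp.op_mul_op (T : ParaOp n V) (hT0 : T.re = 0) : T.op * T.op = -T.imSq := by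
  rw [T.op_eq_sum hT0]
  refine sum_mul_mul_sum_eq (A := CliffordOp n V) (fun i => scalar (gen i)) (fun i => comp (T.im i))
    (fun i => ?_) (fun i k h => ?_) (fun i k => commute_scalar_comp _ _) T.commute_comp_im
  · exact (map_mul scalar _ _).symm.trans ((congrArg scalar (gen_sq i)).trans
      ((map_neg scalar 1).trans (congrArg Neg.neg (map_one scalar))))
  · exact (map_mul scalar _ _).symm.trans ((congrArg scalar (gen_anticomm h)).trans
      ((map_neg scalar _).trans (congrArg Neg.neg (map_mul scalar _ _))))

theorem sub_mul_add_neg_add_mul_neg {A : Type*} [Ring A] {a b c x : A} (h : c * c = -x) :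
    a - b * (c + -c) + c * -c = a + x := by
  rw [add_neg_cancel, mul_zero, sub_zero, mul_neg, h, neg_neg]

theorem pseudoQ_slicePoint (T : ParaOp n V) (hT0 : T.re = 0) (I : UnitVec n) (z : ℂ) :
    pseudoQ T (slicePoint I z) = sliceScalar V I (z ^ 2) + T.imSq := by
  rw [pseudoQ, T.conj_eq_neg hT0, toCl_slicePoint, ← map_pow]
  exact sub_mul_add_neg_add_mul_neg (A := CliffordOp n V) (T.op_mul_op hT0)

/-- For z = iv and c² = -x, one has c² + v² = -(z² + x). -/
theorem isUnit_complexHom_add_of_isUnit {A : Type*} [Ring A] [Algebra ℝ A] (φ : ℂ →ₐ[ℝ] A)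
    {z : ℂ} (hz : z.re = 0) {r : ℝ} (hr : r = z.im ^ 2) {c x : A} (h : c * c = -x)
    (hu : IsUnit (c * c + r • (1 : A))) : IsUnit (φ (z ^ 2) + x) := by
  have h2 : z ^ 2 = ((-z.im ^ 2 : ℝ) : ℂ) := by
    apply Complex.ext <;> simp [pow_two, hz]
  have h3 : φ (z ^ 2) = (-z.im ^ 2) • (1 : A) := by
    rw [h2, ← mul_one ((-z.im ^ 2 : ℝ) : ℂ), ← Complex.real_smul, map_smul, map_one]
  rw [h] at hu
  rw [h3]
  convert hu.neg using 1
  rw [hr]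
  module

theorem isUnit_map_sub_sq_add {A B : Type*} [Ring A] [Algebra ℝ A] [Ring B] [Algebra ℝ B]
    (f : A →ₐ[ℝ] B) {x : A} {a b : ℝ} (h : IsUnit ((x - a • (1 : A)) ^ 2 + b ^ 2 • (1 : A))) :
    IsUnit ((f x - a • (1 : B)) ^ 2 + b ^ 2 • (1 : B)) := by
  simpa using h.map f

theorem HasRealSpectrum.isUnit_comp {S : V →L[ℝ] V} (hS : HasRealSpectrum S) (a b : ℝ)
    (hb : b ≠ 0) : IsUnit ((comp (n := n) S - a • (1 : CliffordOp n V)) ^ 2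
      + b ^ 2 • (1 : CliffordOp n V)) := by
  have h := isUnit_map_sub_sq_add (A := V →L[ℝ] V) (B := CliffordOp n V)
    (compHom (V := V) (n := n)) (hS a b hb)
  rw [compHom_apply] at h
  exact h

theorem isUnit_of_re_ne_zero [CompleteSpace V] (T : ParaOp n V)
    (hT : ∀ i, HasRealSpectrum (T.im i)) (I : UnitVec n) {z : ℂ} (hz : z.re ≠ 0) :
    IsUnit (sliceScalar V I (z ^ 2) + T.imSq) := by
  have h1 : ∀ z i, Commute (sliceScalar V I z) (comp (V := V) (n := n) (T.im i)) :=
    fun _ _ => commute_scalar_comp _ _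
  have h2 := isUnit_add_sum_sq (A := CliffordOp n V) (sliceScalar V I)
    (fun i => comp (V := V) (n := n) (T.im i)) h1 T.commute_comp_im
    (fun i a b hb => (hT i).isUnit_comp a b hb) hz
  exact h2

theorem isUnit_of_notMem_sSpectrum (T : ParaOp n V) (hT0 : T.re = 0) (I : UnitVec n) {z : ℂ}
    (hre : z.re = 0) (hz : slicePoint I z ∉ sSpectrum T) :
    IsUnit (sliceScalar V I (z ^ 2) + T.imSq) := by
  have hu : IsUnit (T.op ^ 2 - (2 * (slicePoint I z).fst) • T.op
      + (‖slicePoint I z‖ ^ 2) • (1 : CliffordOp n V)) := by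
    have := not_not.mp hz
    exact this
  have h0 : (slicePoint I z).fst = 0 := hre
  rw [h0, mul_zero, zero_smul, sub_zero (G := CliffordOp n V), pow_two] at hu
  have h1 : ‖slicePoint I z‖ ^ 2 = z.im ^ 2 := by rw [norm_slicePoint, hre]; ring
  have h2 := isUnit_complexHom_add_of_isUnit (A := CliffordOp n V) (sliceScalar V I) hre h1
    (T.op_mul_op hT0) hu
  exact h2

/-- Only this inclusion of the singular set in the S-spectrum is used, not its converse. -/
theorem re_eq_zero_and_mem_sSpectrum [CompleteSpace V] (T : ParaOp n V) (hT0 : T.re = 0)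
    (hT : ∀ i, HasRealSpectrum (T.im i)) (I : UnitVec n) {z : ℂ}
    (hz : ¬ IsUnit (sliceScalar V I (z ^ 2) + T.imSq)) :
    z.re = 0 ∧ slicePoint I z ∈ sSpectrum T := by
  have hre : z.re = 0 := not_not.mp fun h => hz (isUnit_of_re_ne_zero T hT I h)
  exact ⟨hre, not_not.mp fun h => hz (isUnit_of_notMem_sSpectrum T hT0 I hre h)⟩

end Operators

/-! ### Topology and symmetry of slices, winding numbers near singular points -/

section Slices

variable {n : ℕ}

theorem continuous_slicePoint (I : UnitVec n) : Continuous (slicePoint I) := by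
  unfold slicePoint
  fun_prop

theorem notMem_closure_of_areSeparated {X : Type*} [PseudoEMetricSpace X] {s t : Set X}
    (h : Metric.AreSeparated s t) {y : X} (hy : y ∈ t) : y ∉ closure s := by
  obtain ⟨r, hr, h⟩ := h
  intro hys
  obtain ⟨x, hx, hlt⟩ := EMetric.mem_closure_iff.mp hys r (pos_iff_ne_zero.mpr hr)
  rw [edist_comm] at hlt
  exact (h x hx y hy).not_gt hlt

theorem mem_closure_of_mem_closure_slice {G : Set (Para n)} {I : UnitVec n} {z : ℂ}
    (hz : z ∈ closure (slice G I)) : slicePoint I z ∈ closure G :=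
  (continuous_slicePoint I).closure_preimage_subset G hz

theorem isOpen_slice {G : Set (Para n)} (hG : IsOpen G) (I : UnitVec n) : IsOpen (slice G I) :=
  hG.preimage (continuous_slicePoint I)

/-- Axial symmetry makes the slice invariant under conjugation, which is negation on the imaginary
axis. -/
theorem neg_mem_slice {G : Set (Para n)} (hG : IsAxiallySymmetric G) {I : UnitVec n} {z : ℂ}
    (hre : z.re = 0) (hz : z ∈ slice G I) : -z ∈ slice G I := by
  have hI : ‖(I : EuclideanSpace ℝ (Fin n))‖ = 1 := by simp
  have hn : ‖(slicePoint I z).snd‖ = |z.im| := by simp [slicePoint, norm_smul, hI]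
  have h0 : (slicePoint I z).fst = 0 := hre
  have h := hG _ hz
  rw [hn, h0] at h
  -- Symmetry supplies the points J|Im z|; this is -z for J = -I if Im z ≥ 0 and for J = I if Im z ≤
  -- 0.
  rcases le_total 0 z.im with hi | hi
  · have h1 := h (-I)
    have h2 : slicePoint (-I) ⟨0, |z.im|⟩ = slicePoint I (-z) := by
      simp [slicePoint, hre, abs_of_nonneg hi]
    rw [h2] at h1
    exact h1
  · have h1 := h I
    have h2 : slicePoint I ⟨0, |z.im|⟩ = slicePoint I (-z) := by
      simp [slicePoint, hre, abs_of_nonpos hi]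
    rw [h2] at h1
    exact h1

namespace IsOrientedBoundary

variable {D : Set ℂ} {m : ℕ} {γ : Fin m → ℝ → ℂ}

theorem trace_eq (h : IsOrientedBoundary D γ) : trace γ = frontier D := h.frontier_eq.symm

theorem eventually_of_mem (h : IsOrientedBoundary D γ) (hD : IsOpen D) {w : ℂ} (hw : w ∈ D)
    (hw' : -w ∈ D) :
    ∀ᶠ v in 𝓝 w, v ∉ trace γ ∧ -v ∉ trace γ ∧ meanWinding γ v = 1 := by
  filter_upwards [hD.mem_nhds hw, (hD.preimage continuous_neg).mem_nhds hw'] with v hv hv'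
  rw [h.trace_eq, hD.frontier_eq]
  refine ⟨fun h0 => h0.2 hv, fun h0 => h0.2 hv', ?_⟩
  rw [meanWinding, h.winding_inside v hv, h.winding_inside (-v) hv']
  norm_num

theorem eventually_of_notMem (h : IsOrientedBoundary D γ) {w : ℂ} (hw : w ∉ closure D)
    (hw' : -w ∉ closure D) :
    ∀ᶠ v in 𝓝 w, v ∉ trace γ ∧ -v ∉ trace γ ∧ meanWinding γ v = 0 := by
  have ho : IsOpen (closure D)ᶜ := isClosed_closure.isOpen_compl
  filter_upwards [ho.mem_nhds hw, (ho.preimage continuous_neg).mem_nhds hw'] with v hv hv'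
  rw [h.trace_eq]
  refine ⟨fun h0 => hv h0.1, fun h0 => hv' h0.1, ?_⟩
  rw [meanWinding, h.winding_outside v hv, h.winding_outside (-v) hv']
  norm_num

end IsOrientedBoundary

end Slices

/-! ### Normalization of the integrals -/

section Integrals

variable {A : Type*} [NormedRing A] [NormedAlgebra ℝ A]

/-- The 4i collects the -4 of the resolvent and the -i of ds_I; then -4i/(8π) = 1/(2πi). -/
theorem smul_complexHom_eq (φ : ℂ →ₐ[ℝ] A) (y : A) :
    (-(1 / (8 * Real.pi))) • (φ (4 * Complex.I) * y) = φ (2 * Real.pi * Complex.I)⁻¹ * y := by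
  rw [← smul_mul_assoc, ← map_smul]
  congr 2
  rw [Complex.real_smul, mul_inv, Complex.inv_I]
  push_cast
  have : (Real.pi : ℂ) ≠ 0 := Complex.ofReal_ne_zero.mpr Real.pi_ne_zero
  field_simp
  norm_num

variable {φ : ℂ →ₐ[ℝ] A} {x : A}

/-- With the resolvent on the left, commutation of φ with x is what moves it past the scalars; with
the resolvent on the right nothing has to be moved. -/
theorem neg_four_smul_mul_mul (hx : ∀ z, Commute (φ z) x) (u v w : ℂ) :
    ((-4 : ℝ) • resolventAt φ x u) * φ (v * -Complex.I) * φ w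
      = φ (4 * Complex.I) * (φ v * (φ w * resolventAt φ x u)) := by
  have h1 := fun z => (commute_complexHom_resolventAt hx u z).eq
  have h2 : (-4 : ℝ) • (v * -Complex.I * w) = 4 * Complex.I * (v * w) := by
    rw [Complex.real_smul]; push_cast; ring
  rw [mul_assoc, ← map_mul, smul_mul_assoc, ← h1, ← smul_mul_assoc, ← map_smul, h2,
    map_mul φ (4 * Complex.I), map_mul φ v, mul_assoc (φ (4 * Complex.I)), mul_assoc (φ v)]

theorem mul_mul_neg_four_smul (u v w : ℂ) :
    φ w * φ (v * -Complex.I) * ((-4 : ℝ) • resolventAt φ x u)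
      = φ (4 * Complex.I) * (φ v * (φ w * resolventAt φ x u)) := by
  have h2 : (-4 : ℝ) • (w * (v * -Complex.I)) = 4 * Complex.I * (v * w) := by
    rw [Complex.real_smul]; push_cast; ring
  rw [← map_mul, mul_smul_comm, ← smul_mul_assoc, ← map_smul, h2,
    map_mul φ (4 * Complex.I), map_mul φ v, mul_assoc (φ (4 * Complex.I)), mul_assoc (φ v)]

variable [CompleteSpace A] {m : ℕ} {γ : Fin m → ℝ → ℂ}

theorem IsCycle.smul_sum_integral_eq (h : IsCycle γ)
    (hγ : ∀ z ∈ trace γ, IsUnit (φ (z ^ 2) + x)) {f : Fin m → ℝ → A}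
    (hf : ∀ j t, f j t = φ (4 * Complex.I)
      * (φ (deriv (γ j) t) * (φ (γ j t) * resolventAt φ x (γ j t ^ 2)))) :
    (-(1 / (8 * Real.pi))) • ∑ j, ∫ t in (0 : ℝ)..1, f j t = rieszProj φ x γ := by
  have hc : ContinuousOn (fun z => φ z * resolventAt φ x (z ^ 2)) (trace γ) :=
    (continuous_complexHom φ).continuousOn.mul (continuousOn_resolventAt_sq hγ)
  have h1 : ∀ j, ∫ t in (0 : ℝ)..1, f j t = φ (4 * Complex.I)
      * ∫ t in (0 : ℝ)..1, φ (deriv (γ j) t) * (φ (γ j t) * resolventAt φ x (γ j t ^ 2)) := by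
    intro j
    simp only [hf]
    exact (ContinuousLinearMap.mul ℝ A (φ (4 * Complex.I))).intervalIntegral_comp_comm
      (h.intervalIntegrable φ hc j)
  simp only [h1]
  rw [← Finset.mul_sum, smul_complexHom_eq]
  rfl

end Integrals

/-! ### Both slice integrals as Riesz projections -/

section SliceIntegrals

variable {V : Type*} [NormedAddCommGroup V] [NormedSpace ℝ V]

theorem resolventD_slicePoint (T : ParaOp 5 V) (hT0 : T.re = 0) (I : UnitVec 5) (z : ℂ) :
    resolventD T (slicePoint I z)
      = (-4 : ℝ) • resolventAt (sliceScalar V I) T.imSq (z ^ 2) := by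
  rw [resolventD, pseudoQ_slicePoint T hT0]
  rfl

theorem scalar_slicePoint (I : UnitVec 5) (z : ℂ) :
    scalar (slicePoint I z).toCl = sliceScalar V I z := by
  rw [toCl_slicePoint]; rfl

theorem scalar_slicePoint_mul_neg (I : UnitVec 5) (z : ℂ) :
    scalar ((slicePoint I z).toCl * -(slicePoint I Complex.I).toCl)
      = sliceScalar V I (z * -Complex.I) := by
  rw [toCl_slicePoint, toCl_slicePoint, ← map_neg, ← map_mul]; rfl

variable (T : ParaOp 5 V) (I : UnitVec 5)

theorem resolventD_mul_scalar (hT0 : T.re = 0) (z w : ℂ) :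
    resolventD T (slicePoint I z)
        * scalar ((slicePoint I w).toCl * -(slicePoint I Complex.I).toCl)
        * scalar (slicePoint I z).toCl
      = sliceScalar V I (4 * Complex.I) * (sliceScalar V I w
        * (sliceScalar V I z * resolventAt (sliceScalar V I) T.imSq (z ^ 2))) := by
  have h := neg_four_smul_mul_mul (A := CliffordOp 5 V) (φ := sliceScalar V I) (x := T.imSq)
    (fun _ => T.commute_scalar_imSq _) (z ^ 2) w z
  rw [resolventD_slicePoint T hT0, scalar_slicePoint, scalar_slicePoint_mul_neg]
  exact h

theorem scalar_mul_resolventD (hT0 : T.re = 0) (z w : ℂ) :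
    scalar (slicePoint I z).toCl
        * scalar ((slicePoint I w).toCl * -(slicePoint I Complex.I).toCl)
        * resolventD T (slicePoint I z)
      = sliceScalar V I (4 * Complex.I) * (sliceScalar V I w
        * (sliceScalar V I z * resolventAt (sliceScalar V I) T.imSq (z ^ 2))) := by
  have h := mul_mul_neg_four_smul (A := CliffordOp 5 V) (φ := sliceScalar V I) (x := T.imSq)
    (z ^ 2) w z
  rw [resolventD_slicePoint T hT0, scalar_slicePoint, scalar_slicePoint_mul_neg]
  exact h

variable [CompleteSpace V] {m : ℕ} {γ : Fin m → ℝ → ℂ}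

theorem sliceIntegral_resolventD_right (hT0 : T.re = 0) (h : IsCycle γ)
    (hγ : ∀ z ∈ trace γ, IsUnit (sliceScalar V I (z ^ 2) + T.imSq)) :
    (-(1 / (8 * Real.pi))) • sliceIntegral I γ (fun p => resolventD T p) (fun p => scalar p.toCl)
      = rieszProj (sliceScalar V I) T.imSq γ := by
  have h1 := h.smul_sum_integral_eq (A := CliffordOp 5 V) hγ
    (f := fun j t => resolventD T (slicePoint I (γ j t))
      * scalar ((slicePoint I (deriv (γ j) t)).toCl * -(slicePoint I Complex.I).toCl)
      * scalar (slicePoint I (γ j t)).toCl) fun _ _ => resolventD_mul_scalar T I hT0 _ _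
  exact h1

theorem sliceIntegral_resolventD_left (hT0 : T.re = 0) (h : IsCycle γ)
    (hγ : ∀ z ∈ trace γ, IsUnit (sliceScalar V I (z ^ 2) + T.imSq)) :
    (-(1 / (8 * Real.pi))) • sliceIntegral I γ (fun s => scalar s.toCl) (fun s => resolventD T s)
      = rieszProj (sliceScalar V I) T.imSq γ := by
  have h1 := h.smul_sum_integral_eq (A := CliffordOp 5 V) hγ
    (f := fun j t => scalar (slicePoint I (γ j t)).toCl
      * scalar ((slicePoint I (deriv (γ j) t)).toCl * -(slicePoint I Complex.I).toCl)
      * resolventD T (slicePoint I (γ j t))) fun _ _ => scalar_mul_resolventD T I hT0 _ _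
  exact h1

end SliceIntegrals

end SliceOp

end

theorem mainTheorem5 {V : Type*} [NormedAddCommGroup V] [NormedSpace ℝ V] [CompleteSpace V]
    (T : SliceOp.ParaOp 5 V) (hT0 : T.re = 0) (hT : ∀ i, SliceOp.HasRealSpectrum (T.im i))
    (σ₁ σ₂ : Set (SliceOp.Para 5)) (hσ : SliceOp.sSpectrum T = σ₁ ∪ σ₂)
    (hsep : Metric.AreSeparated σ₁ σ₂)
    (G₁ G₂ : Set (SliceOp.Para 5))
    (hG₁ : SliceOp.IsBoundedSliceCauchyDomain G₁) (hG₂ : SliceOp.IsBoundedSliceCauchyDomain G₂)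
    (hσG : σ₁ ⊆ G₁) (hG : closure G₁ ⊆ G₂) (hGσ : Metric.AreSeparated G₂ σ₂)
    (I : SliceOp.UnitVec 5)
    (m₁ : ℕ) (γ₁ : Fin m₁ → ℝ → ℂ) (hγ₁ : SliceOp.IsOrientedBoundary (SliceOp.slice G₁ I) γ₁)
    (m₂ : ℕ) (γ₂ : Fin m₂ → ℝ → ℂ) (hγ₂ : SliceOp.IsOrientedBoundary (SliceOp.slice G₂ I) γ₂)
    (P : SliceOp.CliffordOp 5 V)
    (hP : P = (-(1 / (8 * Real.pi))) • SliceOp.sliceIntegral I γ₁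
      (fun p => SliceOp.resolventD T p) (fun p => SliceOp.scalar p.toCl)) :
    P * P = P ∧
    P = (-(1 / (8 * Real.pi))) • SliceOp.sliceIntegral I γ₂
      (fun s => SliceOp.scalar s.toCl) (fun s => SliceOp.resolventD T s) := by
  -- Each singular w lies, together with -w, either in the slice of G₁ or off the closure of the
  -- slice of G₂. This keeps both contours off the singular set and fixes the mean winding numbers
  -- there as 1 or 0.
  open SliceOp in
  have hK : ∀ w, ¬ IsUnit (sliceScalar V I (w ^ 2) + T.imSq) →
      (w ∈ slice G₁ I ∧ -w ∈ slice G₁ I) ∨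
        (w ∉ closure (slice G₂ I) ∧ -w ∉ closure (slice G₂ I)) := by
    intro w hw
    obtain ⟨hre, hmem⟩ := re_eq_zero_and_mem_sSpectrum T hT0 hT I hw
    obtain ⟨hre', hmem'⟩ := re_eq_zero_and_mem_sSpectrum T hT0 hT I (z := -w) (by rwa [neg_sq])
    have hsym : ∀ {z}, z.re = 0 → z ∈ slice G₁ I → -z ∈ slice G₁ I :=
      neg_mem_slice hG₁.axiallySymmetric
    have hfar : ∀ {z}, slicePoint I z ∈ σ₂ → z ∉ closure (slice G₂ I) := fun hz hz' =>
      notMem_closure_of_areSeparated hGσ hz (mem_closure_of_mem_closure_slice hz')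
    rw [hσ] at hmem hmem'
    rcases hmem with h | h
    · exact Or.inl ⟨hσG h, hsym hre (hσG h)⟩
    -- For w in σ₂ the point -w is also in the S-spectrum; should it lie in σ₁, symmetry of G₁
    -- brings w back into G₁, so this case needs no separate exclusion.
    · rcases hmem' with h' | h'
      · exact Or.inl ⟨by simpa using hsym hre' (hσG h'), hσG h'⟩
      · exact Or.inr ⟨hfar h, hfar h'⟩
  have h12 : closure (SliceOp.slice G₁ I) ⊆ SliceOp.slice G₂ I := fun z hz =>
    hG (SliceOp.mem_closure_of_mem_closure_slice hz)
  have ho₁ := SliceOp.isOpen_slice hG₁.isOpen I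
  have ho₂ := SliceOp.isOpen_slice hG₂.isOpen I
  have hu₁ : ∀ z ∈ SliceOp.trace γ₁, IsUnit (SliceOp.sliceScalar V I (z ^ 2) + T.imSq) := by
    intro z hz
    rw [hγ₁.trace_eq, ho₁.frontier_eq] at hz
    by_contra hzu
    rcases hK z hzu with h | h
    · exact hz.2 h.1
    · exact h.1 (subset_closure (h12 hz.1))
  have hu₂ : ∀ z ∈ SliceOp.trace γ₂, IsUnit (SliceOp.sliceScalar V I (z ^ 2) + T.imSq) := by
    intro z hz
    rw [hγ₂.trace_eq, ho₂.frontier_eq] at hz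
    by_contra hzu
    rcases hK z hzu with h | h
    · exact hz.2 (h12 (subset_closure h.1))
    · exact h.1 hz.1
  have hcl : ∀ {z}, z ∉ closure (SliceOp.slice G₂ I) → z ∉ closure (SliceOp.slice G₁ I) :=
    fun hz hz' => hz (subset_closure (h12 hz'))
  have hcomm : ∀ z, Commute (SliceOp.sliceScalar V I z) T.imSq := fun _ => T.commute_scalar_imSq _
  rw [SliceOp.sliceIntegral_resolventD_right T I hT0 hγ₁.isCycle hu₁] at hP
  rw [SliceOp.sliceIntegral_resolventD_left T I hT0 hγ₂.isCycle hu₂, hP]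
  refine ⟨hγ₁.isCycle.rieszProj_mul_self hcomm hu₁ fun w hw => ?_,
    SliceOp.rieszProj_eq hγ₁.isCycle hγ₂.isCycle hcomm hu₁ hu₂ fun w hw => ?_⟩
  · rcases hK w hw with h | h
    · exact ⟨1, by ring, hγ₁.eventually_of_mem ho₁ h.1 h.2⟩
    · exact ⟨0, by ring, hγ₁.eventually_of_notMem (hcl h.1) (hcl h.2)⟩
  · rcases hK w hw with h | h
    · filter_upwards [hγ₁.eventually_of_mem ho₁ h.1 h.2, hγ₂.eventually_of_mem ho₂
        (h12 (subset_closure h.1)) (h12 (subset_closure h.2))] with v h1 h2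
      exact ⟨⟨h1.1, h1.2.1⟩, ⟨h2.1, h2.2.1⟩, h1.2.2.trans h2.2.2.symm⟩
    · filter_upwards [hγ₁.eventually_of_notMem (hcl h.1) (hcl h.2),
        hγ₂.eventually_of_notMem h.1 h.2] with v h1 h2
      exact ⟨⟨h1.1, h1.2.1⟩, ⟨h2.1, h2.2.1⟩, h1.2.2.trans h2.2.2.symm⟩
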